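/- **Strong duality and dual attainment for entropic vector quantile regression.** Let $d_x,d_y$ be dimensions and $\varepsilon>0$. Let $\mu$ be a Borel probability measure on $\mathbb{R}^{d_y}$ with finite second moment, and let $\nu$ be the law on $\mathbb{R}^{d_x}\times\mathbb{R}^{d_y}$ of a pair $(X,Y)$ with $\mathbb{E}[\|X\|^2+\|Y\|^2]<\infty$ and $\mathbb{E}[X]=0$ (the supports of $\mu$ and $\nu$ may be unbounded). Put $c(u,y)=\tfrac12\|u-y\|^2$ and $R=\mu\otimes\nu$, and write $\mathsf{KL}(P\|Q)=\int\log\frac{dP}{dQ}\,dP$ if $P\ll Q$ and $\mathsf{KL}(P\|Q)=\infty$ otherwise. *Primal problem.* Let $\mathcal{Q}$ be the set of couplings $\pi$ of $\mu$ and $\nu$ such that, with $\pi_u$ the conditional distribution under $\pi$ of the second component $(x,y)$ given the first component $u$, one has $\int x\,d\pi_u(x,y)=0$ for $\mu$-a.e. $u$. Set $$\mathsf{T}^\varepsilon=\inf_{\pi\in\mathcal{Q}}\Big(\int c\,d\pi+\varepsilon\,\mathsf{KL}(\pi\|R)\Big).$$ *Dual problem.* Set $$\mathsf{D}^\varepsilon=\sup_{(f,g,h)}\Big(\int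 f\,d\mu+\int h\,d\nu-\varepsilon\int e^{\frac1\varepsilon(f(u)+\langle g(u),x\rangle+h(x,y)-c(u,y))}\,dR(u,x,y)+\varepsilon\Big),$$ where the supremum is over $(f,g,h)\in L^1(\mu)\times L^1(\mu;\mathbb{R}^{d_x})\times L^1(\nu)$ and the objective is $-\infty$ when the exponential integral is infinite. *Assumptions.* Let $\tilde R$ be the probability measure with $d\tilde R=\alpha^{-1}e^{-c/\varepsilon}\,dR$, $\alpha=\int e^{-c/\varepsilon}\,dR$. Let $\tilde{\mathsf d}((u,x,y),(u',x',y'))=\min(\|u-u'\|,1)+\|x-x'\|+\min(\|y-y'\|,1)$, let $\tilde{\mathcal{P}}_1$ be the set of Borel probability measures $P$ on $\mathbb{R}^{d_y}\times\mathbb{R}^{d_x}\times\mathbb{R}^{d_y}$ with $\int\tilde{\mathsf d}(\cdot,0)\,dP<\infty$, and let $\tilde{\mathsf W}_1(P,Q)=\inf_\gamma\int\tilde{\mathsf d}\,d\gamma$, the infimum being over couplings $\gamma$ of $P$ and $Q$. Assume that 1. the matrix $\mathbb{E}[XX^\top]$ is invertible; and 2. for every $0<a<\infty$ the set $\{Q\in\tilde{\mathcal{P}}_1:\mathsf{KL}(Q\|\tilde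 R)\le a\}$ is compact in the $\tilde{\mathsf W}_1$-topology. Then the following hold. (i) (Strong duality) $\mathsf{T}^\varepsilon=\mathsf{D}^\varepsilon$. (ii) (Dual attainment) The primal problem has a unique optimal solution $\pi^\varepsilon$, and there exist $(f^\varepsilon,g^\varepsilon,h^\varepsilon)\in L^1(\mu)\times L^1(\mu;\mathbb{R}^{d_x})\times L^1(\nu)$ such that $\pi^\varepsilon\ll R$ and, $R$-a.e., $$\frac{d\pi^\varepsilon}{dR}(u,x,y)=e^{\frac1\varepsilon(f^\varepsilon(u)+\langle g^\varepsilon(u),x\rangle+h^\varepsilon(x,y)-c(u,y))}.$$ The triplet $(f^\varepsilon,g^\varepsilon,h^\varepsilon)$ attains the supremum in the dual problem, and $\mathsf{T}^\varepsilon=\int f^\varepsilon\,d\mu+\int h^\varepsilon\,d\nu$; in particular, $\mathsf{T}^\varepsilon$ is finite. -/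

import Mathlib

open MeasureTheory ProbabilityTheory Set
open scoped ENNReal

namespace EntropicVQR

/-- The Euclidean space `ℝ^d` with its standard norm and inner product. -/
abbrev E (d : ℕ) : Type := EuclideanSpace ℝ (Fin d)

/-- The space `ℝ^{dy} × ℝ^{dx+dy}` of points `(u, x, y)`, written `(u, (x, y))`. -/
abbrev Z (dx dy : ℕ) : Type := E dy × (E dx × E dy)

/-- `γ` is a coupling of `P` and `Q`, i.e. `γ ∈ Π(P, Q)`. -/
def IsCoupling {A B : Type*} [MeasurableSpace A] [MeasurableSpace B]
    (γ : Measure (A × B)) (P : Measure A) (Q : Measure B) : Prop :=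
  γ.map Prod.fst = P ∧ γ.map Prod.snd = Q

/-- The ground cost `c(u, y) = ‖u - y‖² / 2`. -/
noncomputable def cost {dx dy : ℕ} (z : Z dx dy) : ℝ := ‖z.1 - z.2.2‖ ^ 2 / 2

/-- The feasible set `𝒬`: couplings `π` of `(μ, ν)` such that the conditional distributions `π_u`
of `(X, Y)` given `U = u` satisfy `∫ x dπ_u(x, y) = 0` for `μ`-a.e. `u`. -/
def Feasible {dx dy : ℕ} (μ : Measure (E dy)) (ν : Measure (E dx × E dy))
    (π : ProbabilityMeasure (Z dx dy)) : Prop :=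
  IsCoupling (π : Measure (Z dx dy)) μ ν ∧
    ∀ᵐ u ∂μ, ∫ w, w.1 ∂((π : Measure (Z dx dy)).condKernel u) = 0

/-- The primal objective `∫ c dπ + ε KL(π ‖ μ ⊗ ν)`, with values in `[0, ∞]`. -/
noncomputable def primalObj {dx dy : ℕ} (ε : ℝ) (μ : Measure (E dy)) (ν : Measure (E dx × E dy))
    (π : ProbabilityMeasure (Z dx dy)) : ℝ≥0∞ :=
  ∫⁻ z, ENNReal.ofReal (cost z) ∂(π : Measure (Z dx dy)) +
    ENNReal.ofReal ε * InformationTheory.klDiv (π : Measure (Z dx dy)) (μ.prod ν)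

/-- The optimal value `T^ε(μ, ν)` of the primal problem. -/
noncomputable def primalValue {dx dy : ℕ} (ε : ℝ) (μ : Measure (E dy))
    (ν : Measure (E dx × E dy)) : ℝ≥0∞ :=
  ⨅ (π : ProbabilityMeasure (Z dx dy)) (_ : Feasible μ ν π), primalObj ε μ ν π

/-- `π` is an optimal solution of the primal problem. -/
def IsPrimalOptimal {dx dy : ℕ} (ε : ℝ) (μ : Measure (E dy)) (ν : Measure (E dx × E dy))
    (π : ProbabilityMeasure (Z dx dy)) : Prop :=
  Feasible μ ν π ∧ primalObj ε μ ν π = primalValue ε μ ν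

/-- `(f, g, h) ∈ L¹(μ) × L¹(μ; ℝ^{dx}) × L¹(ν)`, for Borel representatives. -/
structure DualAdmissible {dx dy : ℕ} (μ : Measure (E dy)) (ν : Measure (E dx × E dy))
    (f : E dy → ℝ) (g : E dy → E dx) (h : E dx × E dy → ℝ) : Prop where
  measurable_f : Measurable f
  measurable_g : Measurable g
  measurable_h : Measurable h
  integrable_f : Integrable f μ
  integrable_g : Integrable g μ
  integrable_h : Integrable h ν

/-- The function `exp ((f(u) + ⟨g(u), x⟩ + h(x, y) - c(u, y)) / ε)`. -/
noncomputable def gibbsDensity {dx dy : ℕ} (ε : ℝ) (f : E dy → ℝ) (g : E dy → E dx)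
    (h : E dx × E dy → ℝ) (z : Z dx dy) : ℝ :=
  Real.exp ((1 / ε) * (f z.1 + inner ℝ (g z.1) z.2.1 + h z.2 - cost z))

/-- `ι^ε(f, g, h) = ε ∫ exp ((f + ⟨g, x⟩ + h - c) / ε) d(μ ⊗ ν) - ε`, possibly equal to `+∞`. -/
noncomputable def iota {dx dy : ℕ} (ε : ℝ) (μ : Measure (E dy)) (ν : Measure (E dx × E dy))
    (f : E dy → ℝ) (g : E dy → E dx) (h : E dx × E dy → ℝ) : EReal :=
  ((ENNReal.ofReal ε *
    ∫⁻ z, ENNReal.ofReal (gibbsDensity ε f g h z) ∂(μ.prod ν) : ℝ≥0∞) : EReal) - (ε : EReal)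

/-- The dual objective `∫ f dμ + ∫ h dν - ι^ε(f, g, h)`, possibly equal to `-∞`. -/
noncomputable def dualObj {dx dy : ℕ} (ε : ℝ) (μ : Measure (E dy)) (ν : Measure (E dx × E dy))
    (f : E dy → ℝ) (g : E dy → E dx) (h : E dx × E dy → ℝ) : EReal :=
  ((∫ u, f u ∂μ + ∫ w, h w ∂ν : ℝ) : EReal) - iota ε μ ν f g h

/-- The optimal value `D^ε(μ, ν)` of the dual problem. -/
noncomputable def dualValue {dx dy : ℕ} (ε : ℝ) (μ : Measure (E dy))
    (ν : Measure (E dx × E dy)) : EReal :=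
  ⨆ (f : E dy → ℝ) (g : E dy → E dx) (h : E dx × E dy → ℝ) (_ : DualAdmissible μ ν f g h),
    dualObj ε μ ν f g h

/-- The probability measure `R̃` with density proportional to `exp (-c / ε)` with respect to
`μ ⊗ ν`. -/
noncomputable def refMeasure {dx dy : ℕ} (ε : ℝ) (μ : Measure (E dy))
    (ν : Measure (E dx × E dy)) : Measure (Z dx dy) :=
  (μ.prod ν).tilted (fun z => -cost z / ε)

/-- The modified metric
`d̃((u,x,y),(u',x',y')) = ‖u - u'‖ ∧ 1 + ‖x - x'‖ + ‖y - y'‖ ∧ 1`. -/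
noncomputable def modDist {dx dy : ℕ} (z z' : Z dx dy) : ℝ :=
  min ‖z.1 - z'.1‖ 1 + ‖z.2.1 - z'.2.1‖ + min ‖z.2.2 - z'.2.2‖ 1

/-- The modified `1`-Wasserstein distance `W̃₁`. -/
noncomputable def modW1 {dx dy : ℕ} (P Q : Measure (Z dx dy)) : ℝ≥0∞ :=
  ⨅ (γ : Measure (Z dx dy × Z dx dy)) (_ : IsCoupling γ P Q),
    ∫⁻ p, ENNReal.ofReal (modDist p.1 p.2) ∂γ

/-- The space `P̃₁` of Borel probability measures `P` with `∫ d̃(·, 0) dP < ∞`. -/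
def ModP1 (dx dy : ℕ) : Type :=
  {P : ProbabilityMeasure (Z dx dy) //
    ∫⁻ z, ENNReal.ofReal (modDist z 0) ∂(P : Measure (Z dx dy)) < ∞}

/-- The underlying measure of an element of `P̃₁`. -/
def ModP1.toMeasure {dx dy : ℕ} (P : ModP1 dx dy) : Measure (Z dx dy) :=
  (P.1 : Measure (Z dx dy))

/-- The `W̃₁`-topology on `P̃₁`: the topology generated by the open balls of `W̃₁`. -/
instance ModP1.instTopologicalSpace (dx dy : ℕ) : TopologicalSpace (ModP1 dx dy) :=
  TopologicalSpace.generateFrom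
    {B | ∃ (P : ModP1 dx dy) (r : ℝ),
      0 < r ∧ B = {Q | modW1 P.toMeasure Q.toMeasure < ENNReal.ofReal r}}

/-- Coercivity of `Q ↦ KL(Q ‖ S)` in `W̃₁`: all sublevel sets in `P̃₁` at levels `0 < a < ∞`
are compact for the `W̃₁`-topology. -/
def KLCoercive {dx dy : ℕ} (S : Measure (Z dx dy)) : Prop :=
  ∀ a : ℝ, 0 < a →
    IsCompact {Q : ModP1 dx dy | InformationTheory.klDiv Q.toMeasure S ≤ ENNReal.ofReal a}

/-- The second moment matrix `E[X Xᵀ]` for `(X, Y) ∼ ν`. -/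
noncomputable def secondMoment {dx dy : ℕ} (ν : Measure (E dx × E dy)) :
    Matrix (Fin dx) (Fin dx) ℝ :=
  Matrix.of fun i j => ∫ w, w.1 i * w.1 j ∂ν

end EntropicVQR

/-! Write p for the density of π with respect to R. Feasibility is a family of linear constraints: π
and R agree on every f(u) + ⟨g(u), x⟩ + h(x, y) with bounded f, g, h (`Feasible.integral_eq`,
`feasible_of_integral_eq`). Up to the factor ε, the primal problem is to minimize ∫ (c p / ε + klFun
p) dR under these constraints. `IsEntropyProblem` isolates this abstract problem; the density 1 is
admissible because X is centred.

Existence and uniqueness come from a quantitative convexity of `klFun`: the midpoint gap dominates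
(√p - √q)², so square roots of a minimizing sequence are Cauchy in L². All couplings give ‖X‖ the
same second moment, which lets the unbounded constraints ⟨g(u), x⟩ pass to the limit
(`IsEntropyProblem.exists_minimizer`).

Comparing the minimizer with the segment towards the density 1 shows that p > 0 and that log p is
R-integrable. Perturbing p to (1 + t k) p with k bounded shows that every bounded k annihilating the
constraint functions in L¹(p dR) annihilates log p + c / ε. By Hahn–Banach this function is an L¹(p
dR) limit, hence along a subsequence an a.e. limit, of constraint functions.

Since E X = 0 and E[X Xᵀ] is invertible, (1, X) lies in no proper subspace. Hence a.e. limits of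
f_n(u) + ⟨g_n(u), x⟩ + h_n(x, y) keep this form, and integrability of the sum passes to each
potential (`exists_eq_add_inner_add_of_tendsto`, `integrable_of_integrable_add_inner_add`). This is
the Gibbs form of p. Weak duality is a pointwise Fenchel–Young inequality, and the potentials of p
attain equality. -/

namespace EntropicVQR
open Filter Topology

/-! ### The dual of L¹ and approximation by annihilators. -/

section LOneDual

variable {Ω : Type*} [MeasurableSpace Ω]

/-- Continuous linear functionals on `L¹` of a probability measure are given by bounded functions. -/
theorem exists_bounded_representative (P : Measure Ω) [IsProbabilityMeasure P]
    (ℓ : (Ω →₁[P] ℝ) →L[ℝ] ℝ) :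
    ∃ k : Ω → ℝ, Measurable k ∧ (∃ M, ∀ z, |k z| ≤ M) ∧
      ∀ (f : Ω → ℝ) (hf : Integrable f P), ℓ (hf.toL1 f) = ∫ z, k z * f z ∂P := by
  have hmem (f : Lp ℝ 2 P) : Integrable f P :=
    (Lp.memLp f).integrable one_le_two
  let ι : Lp ℝ 2 P →ₗ[ℝ] (Ω →₁[P] ℝ) :=
    { toFun := fun f => (hmem f).toL1 f
      map_add' := fun f g => by
        rw [← Integrable.toL1_add]
        exact (Integrable.toL1_eq_toL1_iff _ _ _ _).2 (Lp.coeFn_add f g)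
      map_smul' := fun a f => by
        rw [RingHom.id_apply, ← Integrable.toL1_smul]
        exact (Integrable.toL1_eq_toL1_iff _ _ _ _).2 (Lp.coeFn_smul a f) }
  have hι (f : Lp ℝ 2 P) : ‖ι f‖ ≤ 1 * ‖f‖ := by
    rw [one_mul, Lp.norm_def f]
    change ‖(hmem f).toL1 f‖ ≤ _
    rw [Integrable.norm_toL1_eq_lintegral_enorm, ← eLpNorm_one_eq_lintegral_enorm]
    exact ENNReal.toReal_mono (Lp.eLpNorm_ne_top f)
      (eLpNorm_le_eLpNorm_of_exponent_le one_le_two (Lp.aestronglyMeasurable f))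
  let T : StrongDual ℝ (Lp ℝ 2 P) := ℓ.comp (ι.mkContinuous 1 hι)
  let κ : Lp ℝ 2 P := (InnerProductSpace.toDual ℝ (Lp ℝ 2 P)).symm T
  have hκ (f : Ω → ℝ) (hf : MemLp f 2 P) :
      ℓ ((hf.integrable one_le_two).toL1 f) = ∫ z, κ z * f z ∂P := by
    have h1 : T (hf.toLp f) = inner ℝ κ (hf.toLp f) :=
      (InnerProductSpace.toDual_symm_apply).symm
    have h2 : T (hf.toLp f) = ℓ ((hf.integrable one_le_two).toL1 f) := by
      change ℓ ((hmem (hf.toLp f)).toL1 _) = _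
      congr 1
      exact (Integrable.toL1_eq_toL1_iff _ _ _ _).2 hf.coeFn_toLp
    rw [← h2, h1, L2.inner_def]
    refine integral_congr_ae ?_
    filter_upwards [hf.coeFn_toLp] with z hz
    simp [hz, mul_comm]
  -- Testing on indicators bounds the mean of the Riesz representative κ over every set by ‖ℓ‖,
  -- hence κ itself almost everywhere.
  have hset (s : Set Ω) (hs : MeasurableSet s) : |∫ z in s, κ z ∂P| ≤ ‖ℓ‖ * P.real s := by
    have hm : MemLp (s.indicator fun _ => (1 : ℝ)) 2 P :=
      memLp_indicator_const 2 hs 1 (Or.inr (measure_ne_top P s))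
    have h1 := hκ _ hm
    have h2 : ∫ z, κ z * s.indicator (fun _ => (1 : ℝ)) z ∂P = ∫ z in s, κ z ∂P := by
      rw [← integral_indicator hs]
      congr 1 with z
      by_cases hz : z ∈ s <;> simp [hz]
    rw [← h2, ← h1, ← Real.norm_eq_abs]
    refine (ℓ.le_opNorm _).trans (le_of_eq ?_)
    congr 1
    rw [L1.norm_of_fun_eq_integral_norm]
    have : (fun z => ‖s.indicator (fun _ => (1 : ℝ)) z‖) = s.indicator (fun _ => (1 : ℝ)) := by
      ext z
      by_cases hz : z ∈ s <;> simp [hz]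
    rw [this, integral_indicator hs]
    simp
  have hup : ∀ᵐ z ∂P, κ z ≤ ‖ℓ‖ := by
    refine ae_le_of_forall_setIntegral_le (hmem κ) (integrable_const _) fun s hs _ => ?_
    rw [setIntegral_const, smul_eq_mul, mul_comm]
    exact (le_abs_self _).trans (hset s hs)
  have hlo : ∀ᵐ z ∂P, -‖ℓ‖ ≤ κ z := by
    refine ae_le_of_forall_setIntegral_le (integrable_const _) (hmem κ) fun s hs _ => ?_
    rw [setIntegral_const, smul_eq_mul, mul_neg, mul_comm]
    exact neg_le_of_abs_le (hset s hs)
  -- Truncation turns the almost everywhere bound on κ into one valid at every point.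
  let k : Ω → ℝ := fun z => max (-‖ℓ‖) (min (κ z) ‖ℓ‖)
  have hkm : Measurable k :=
    measurable_const.max ((Lp.stronglyMeasurable κ).measurable.min measurable_const)
  have hkb (z : Ω) : |k z| ≤ ‖ℓ‖ :=
    abs_le.2 ⟨le_max_left _ _,
      max_le (by linarith [norm_nonneg ℓ]) (min_le_right _ _)⟩
  have hkκ : k =ᵐ[P] κ := by
    filter_upwards [hup, hlo] with z h1 h2
    simp only [k]
    rw [min_eq_left h1, max_eq_right h2]
  have hint (f : Ω → ℝ) (hf : Integrable f P) : Integrable (fun z => k z * f z) P :=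
    hf.bdd_mul hkm.aestronglyMeasurable (ae_of_all _ fun z => hkb z)
  refine ⟨k, hkm, ⟨‖ℓ‖, hkb⟩, ?_⟩
  have key : ∀ f : Ω →₁[P] ℝ, ℓ f = ∫ z, k z * f z ∂P := by
    refine Lp.induction ENNReal.one_ne_top _ ?_ ?_ ?_
    · intro c s hs hμs
      have hm : MemLp (s.indicator fun _ => c) 2 P :=
        memLp_indicator_const 2 hs c (Or.inr hμs.ne)
      have h1 := hκ _ hm
      have h2 : (Lp.simpleFunc.indicatorConst 1 hs hμs.ne c : Lp ℝ 1 P)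
          = (hm.integrable one_le_two).toL1 _ := by
        rw [Lp.simpleFunc.coe_indicatorConst]
        rfl
      rw [h2, h1]
      refine integral_congr_ae ?_
      filter_upwards [hkκ, (hm.integrable one_le_two).coeFn_toL1] with z h3 h4
      rw [h3, h4]
    · intro f g hf hg _ hf' hg'
      rw [map_add, hf', hg', ← integral_add (hint _ (L1.integrable_coeFn _))
        (hint _ (L1.integrable_coeFn _))]
      refine integral_congr_ae ?_
      filter_upwards [Lp.coeFn_add (hf.toLp f) (hg.toLp g)] with z hz
      rw [hz, Pi.add_apply, mul_add]
    · refine isClosed_eq ℓ.continuous ?_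
      refine LipschitzWith.continuous (K := ‖ℓ‖₊) (LipschitzWith.of_dist_le_mul ?_)
      intro f g
      have hf := L1.integrable_coeFn f
      have hg := L1.integrable_coeFn g
      rw [dist_eq_norm, ← integral_sub (hint _ hf) (hint _ hg), dist_eq_norm,
        L1.norm_eq_integral_norm, coe_nnnorm, ← integral_const_mul]
      refine (norm_integral_le_integral_norm _).trans
        (integral_mono_ae ((hint _ hf).sub (hint _ hg)).norm
          ((L1.integrable_coeFn (f - g)).norm.const_mul _) ?_)
      filter_upwards [Lp.coeFn_sub f g] with z hz
      rw [hz, Pi.sub_apply, ← mul_sub, norm_mul]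
      exact mul_le_mul_of_nonneg_right (hkb z) (norm_nonneg _)
  intro f hf
  rw [key]
  refine integral_congr_ae ?_
  filter_upwards [hf.coeFn_toL1] with z hz
  rw [hz]

/-- If every bounded function annihilating a subspace `V` of `L¹(P)` annihilates `F`, then `F` is an
almost everywhere limit of elements of `V`. -/
theorem exists_seq_tendsto_ae_of_annihilator (P : Measure Ω) [IsProbabilityMeasure P]
    (V : Submodule ℝ (Ω → ℝ)) (hV : ∀ v ∈ V, Integrable v P) (F : Ω → ℝ) (hF : Integrable F P)
    (hann : ∀ k : Ω → ℝ, Measurable k → (∃ M, ∀ z, |k z| ≤ M) →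
      (∀ v ∈ V, ∫ z, k z * v z ∂P = 0) → ∫ z, k z * F z ∂P = 0) :
    ∃ v : ℕ → Ω → ℝ, (∀ n, v n ∈ V) ∧
      ∀ᵐ z ∂P, Tendsto (fun n => v n z) atTop (𝓝 (F z)) := by
  let S : Submodule ℝ (Ω →₁[P] ℝ) :=
    { carrier := {f | ∃ v ∈ V, f =ᵐ[P] v}
      add_mem' := by
        rintro f g ⟨v, hv, hfv⟩ ⟨w, hw, hgw⟩
        exact ⟨v + w, V.add_mem hv hw, (Lp.coeFn_add f g).trans (hfv.add hgw)⟩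
      zero_mem' := ⟨0, V.zero_mem, Lp.coeFn_zero _ _ _⟩
      smul_mem' := by
        rintro a f ⟨v, hv, hfv⟩
        refine ⟨a • v, V.smul_mem a hv, (Lp.coeFn_smul a f).trans ?_⟩
        filter_upwards [hfv] with z hz
        simp [hz] }
  have hmem : hF.toL1 F ∈ S.topologicalClosure := by
    by_contra hnot
    obtain ⟨ℓ, u, hu, hℓ⟩ := geometric_hahn_banach_point_closed
      (S.topologicalClosure.convex) S.isClosed_topologicalClosure hnot
    have hu0 : u < 0 := by simpa using hℓ 0 (Submodule.zero_mem _)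
    have hzero : ∀ b ∈ S.topologicalClosure, ℓ b = 0 := by
      intro b hb
      by_contra hne
      -- A functional bounded below on a subspace vanishes there: this multiple of b has value u -
      -- 1, below the bound u.
      have := hℓ (((u - 1) / ℓ b) • b) (Submodule.smul_mem _ _ hb)
      rw [map_smul, smul_eq_mul, div_mul_cancel₀ _ hne] at this
      linarith
    obtain ⟨k, hkm, hkb, hk⟩ := exists_bounded_representative P ℓ
    have h0 := hann k hkm hkb fun v hv => by
      rw [← hk v (hV v hv)]
      exact hzero _ (S.le_topologicalClosure ⟨v, hv, (hV v hv).coeFn_toL1⟩)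
    rw [← hk F hF] at h0
    linarith
  obtain ⟨s, hsS, hs⟩ := mem_closure_iff_seq_limit.1
    (show hF.toL1 F ∈ closure (S : Set (Ω →₁[P] ℝ)) from hmem)
  obtain ⟨ns, -, hns⟩ := (tendstoInMeasure_of_tendsto_Lp hs).exists_seq_tendsto_ae
  choose v hv hsv using hsS
  refine ⟨fun n => v (ns n), fun n => hv _, ?_⟩
  filter_upwards [hns, ae_all_iff.2 hsv, hF.coeFn_toL1] with z h1 h2 h3
  rw [h3] at h1
  simpa only [h2] using h1

end LOneDual
end EntropicVQR

namespace EntropicVQR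
open Filter Topology
open InformationTheory Real

/-! ### Scalar inequalities for `klFun`. -/

section Scalar

/-- This is log t ≤ t - 1 at t = b / a. Squares appear because it is applied to square roots of
densities; `hab` is absolute continuity, needed because `log 0 = 0`. -/
theorem mul_log_div_ge {a b : ℝ} (ha : 0 ≤ a) (hb : 0 ≤ b) (hab : b = 0 → a = 0) :
    2 * (a ^ 2 - a * b) ≤ a ^ 2 * log (a ^ 2) - a ^ 2 * log (b ^ 2) := by
  rcases ha.eq_or_lt with rfl | ha
  · simp
  have hb : 0 < b := hb.lt_of_ne fun h => ha.ne' (hab h.symm)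
  have h := log_le_sub_one_of_pos (div_pos hb ha)
  rw [log_div hb.ne' ha.ne'] at h
  have h2 := mul_le_mul_of_nonneg_left h (sq_nonneg a)
  have h3 : a ^ 2 * (b / a - 1) = a * b - a ^ 2 := by field_simp
  rw [log_pow, log_pow]
  push_cast
  linarith

/-- Quantitative midpoint convexity of `klFun`. -/
theorem klFun_midpoint_gap {p q : ℝ} (hp : 0 ≤ p) (hq : 0 ≤ q) :
    (√p - √q) ^ 2 / 4 ≤ (klFun p + klFun q) / 2 - klFun ((p + q) / 2) := by
  have hm : 0 ≤ (p + q) / 2 := by positivity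
  set m := (p + q) / 2 with hmdef
  have h1 := mul_log_div_ge (sqrt_nonneg p) (sqrt_nonneg m) (by
    rw [sqrt_eq_zero hm, sqrt_eq_zero hp]; intro h; linarith)
  have h2 := mul_log_div_ge (sqrt_nonneg q) (sqrt_nonneg m) (by
    rw [sqrt_eq_zero hm, sqrt_eq_zero hq]; intro h; linarith)
  simp only [klFun_apply]
  have hpp := sq_sqrt hp
  have hqq := sq_sqrt hq
  have hmm := sq_sqrt hm
  rw [hpp, hmm] at h1
  rw [hqq, hmm] at h2
  have h3 : m * log m = (p * log m + q * log m) / 2 := by rw [hmdef]; ring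
  -- The two bounds give a gap of at least 2m - (√p + √q)√m, and this square bounds (√p + √q)√m by m
  -- + (√p + √q)² / 4.
  nlinarith [sq_nonneg (√p + √q - 2 * √m)]

/-- The graph of `klFun` lies above its tangents. -/
theorem klFun_tangent_le {p x : ℝ} (hp : 0 ≤ p) (hx : 0 < x) :
    klFun x + log x * (p - x) ≤ klFun p := by
  simp only [klFun_apply]
  rcases hp.eq_or_lt with rfl | hp
  · simp; nlinarith
  have h := mul_le_mul_of_nonneg_left (log_le_sub_one_of_pos (div_pos hx hp)) hp.le
  rw [log_div hx.ne' hp.ne', mul_sub_one, mul_div_cancel₀ _ hp.ne'] at h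
  linarith

/-- Expand log((1 + s) p) and use log(1 + s) ≤ s. The first-order term is exact and the error s² p
is integrable whenever p is and s is bounded. -/
theorem klFun_mul_one_add_le {p s : ℝ} (hp : 0 ≤ p) (hs : 0 ≤ 1 + s) :
    klFun ((1 + s) * p) ≤ klFun p + s * (p * log p) + s ^ 2 * p := by
  simp only [klFun_apply]
  rcases hp.eq_or_lt with rfl | hp
  · simp
  rcases hs.eq_or_lt with hs | hs
  · have : s = -1 := by linarith
    subst this
    simp only [add_neg_cancel, zero_mul, log_zero]
    linarith
  rw [log_mul hs.ne' hp.ne']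
  have h : log (1 + s) ≤ s := by linarith [log_le_sub_one_of_pos hs]
  nlinarith [mul_le_mul_of_nonneg_left h (mul_pos hs hp).le]

end Scalar

/-! ### The abstract entropy problem and its convexity. -/

section Minimization

variable {Ω : Type*} [MeasurableSpace Ω]

/-- Densities `p` with respect to `R` that have finite cost and entropy and integrate every element
of `V` like `R` does. -/
structure IsAdmissibleDensity (ρ : Measure Ω) (c W : Ω → ℝ) (V : Submodule ℝ (Ω → ℝ))
    (p : Ω → ℝ) : Prop where
  measurable : Measurable p
  nonneg : ∀ z, 0 ≤ p z
  integrable_weight : Integrable (fun z => W z ^ 2 * p z) ρ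
  integrable_cost : Integrable (fun z => c z * p z) ρ
  integrable_klFun : Integrable (fun z => klFun (p z)) ρ
  integral_eq : ∀ v ∈ V, ∫ z, v z * p z ∂ρ = ∫ z, v z ∂ρ

/-- An entropy minimization problem with linear constraints given by a space `V` of functions
dominated by a weight `W`, whose second moment is controlled by the constraints. -/
structure IsEntropyProblem (ρ : Measure Ω) (c W : Ω → ℝ) (V : Submodule ℝ (Ω → ℝ)) : Prop where
  measurable_cost : Measurable c
  cost_nonneg : ∀ z, 0 ≤ c z
  integrable_cost : Integrable c ρ
  measurable_weight : Measurable W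
  one_le_weight : ∀ z, 1 ≤ W z
  integrable_weight : Integrable (fun z => W z ^ 2) ρ
  measurable_constraint : ∀ v ∈ V, Measurable v
  bound_constraint : ∀ v ∈ V, ∃ C, ∀ z, |v z| ≤ C * W z
  one_mem : (fun _ => (1 : ℝ)) ∈ V
  -- Constraints pass to the limit through Cauchy–Schwarz, which calls for a uniform bound on W²
  -- rather than W.
  integral_weight_le : ∀ p, IsAdmissibleDensity ρ c W V p →
    ∫ z, W z ^ 2 * p z ∂ρ ≤ ∫ z, W z ^ 2 ∂ρ

/-- The transport cost plus relative entropy of the measure with density `p`. -/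
noncomputable def energy (ρ : Measure Ω) (c : Ω → ℝ) (p : Ω → ℝ) : ℝ :=
  ∫ z, (c z * p z + klFun (p z)) ∂ρ

variable {ρ : Measure Ω} {c W : Ω → ℝ} {V : Submodule ℝ (Ω → ℝ)}
  {p q : Ω → ℝ}

theorem IsAdmissibleDensity.integrable_energy (hp : IsAdmissibleDensity ρ c W V p) :
    Integrable (fun z => c z * p z + klFun (p z)) ρ :=
  hp.integrable_cost.add hp.integrable_klFun

theorem IsEntropyProblem.integrable_constraint_mul_of_weight (hP : IsEntropyProblem ρ c W V)
    (hp : Measurable p) (hp0 : ∀ z, 0 ≤ p z) (hpW : Integrable (fun z => W z ^ 2 * p z) ρ) {v : Ω → ℝ} (hv : v ∈ V) :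
    Integrable (fun z => v z * p z) ρ := by
  obtain ⟨C, hC⟩ := hP.bound_constraint v hv
  refine (hpW.const_mul |C|).mono' ((hP.measurable_constraint v hv).mul hp).aestronglyMeasurable
    (ae_of_all _ fun z => ?_)
  have hW := hP.one_le_weight z
  have hv0 : 0 ≤ C * W z := (abs_nonneg _).trans (hC z)
  rw [norm_eq_abs, abs_mul, abs_of_nonneg (hp0 z)]
  have h1 : |v z| ≤ |C| * W z ^ 2 := by
    refine (hC z).trans ?_
    have : C * W z ≤ |C| * W z := mul_le_mul_of_nonneg_right (le_abs_self C) (by linarith)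
    nlinarith [abs_nonneg C]
  rw [← mul_assoc]
  exact mul_le_mul_of_nonneg_right h1 (hp0 z)

theorem IsEntropyProblem.integrable_constraint_mul (hP : IsEntropyProblem ρ c W V)
    (hp : IsAdmissibleDensity ρ c W V p) {v : Ω → ℝ} (hv : v ∈ V) :
    Integrable (fun z => v z * p z) ρ :=
  hP.integrable_constraint_mul_of_weight hp.measurable hp.nonneg hp.integrable_weight hv

theorem IsEntropyProblem.integrable_density (hP : IsEntropyProblem ρ c W V)
    (hp : IsAdmissibleDensity ρ c W V p) : Integrable p ρ := by
  simpa using hP.integrable_constraint_mul hp hP.one_mem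

theorem IsEntropyProblem.admissible_one [IsProbabilityMeasure ρ]
    (hP : IsEntropyProblem ρ c W V) :
    IsAdmissibleDensity ρ c W V fun _ => 1 where
  measurable := measurable_const
  nonneg _ := zero_le_one
  integrable_weight := by simpa using hP.integrable_weight
  integrable_cost := by simpa using hP.integrable_cost
  integrable_klFun := integrable_const _
  integral_eq v _ := by simp

theorem IsEntropyProblem.integral_density [IsProbabilityMeasure ρ]
    (hP : IsEntropyProblem ρ c W V)
    (hp : IsAdmissibleDensity ρ c W V p) : ∫ z, p z ∂ρ = 1 := by
  simpa using hp.integral_eq _ hP.one_mem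

theorem IsEntropyProblem.integrable_mul_log [IsProbabilityMeasure ρ]
    (hP : IsEntropyProblem ρ c W V)
    (hp : IsAdmissibleDensity ρ c W V p) : Integrable (fun z => p z * log (p z)) ρ := by
  refine ((hp.integrable_klFun.add (hP.integrable_density hp)).sub (integrable_const 1)).congr ?_
  refine ae_of_all _ fun z => ?_
  simp [klFun_apply]

theorem IsEntropyProblem.admissible_convexComb (hP : IsEntropyProblem ρ c W V)
    (hp : IsAdmissibleDensity ρ c W V p) (hq : IsAdmissibleDensity ρ c W V q) {t : ℝ}
    (ht0 : 0 ≤ t) (ht1 : t ≤ 1) :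
    IsAdmissibleDensity ρ c W V fun z => (1 - t) * p z + t * q z where
  measurable := (hp.measurable.const_mul _).add (hq.measurable.const_mul _)
  nonneg z := add_nonneg (mul_nonneg (by linarith) (hp.nonneg z)) (mul_nonneg ht0 (hq.nonneg z))
  integrable_weight := by
    refine ((hp.integrable_weight.const_mul (1 - t)).add
      (hq.integrable_weight.const_mul t)).congr (ae_of_all _ fun z => ?_)
    simp only [Pi.add_apply]; ring
  integrable_cost := by
    refine ((hp.integrable_cost.const_mul (1 - t)).add
      (hq.integrable_cost.const_mul t)).congr (ae_of_all _ fun z => ?_)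
    simp only [Pi.add_apply]; ring
  integrable_klFun := by
    have hm : Measurable fun z => (1 - t) * p z + t * q z :=
      (hp.measurable.const_mul _).add (hq.measurable.const_mul _)
    refine ((hp.integrable_klFun.const_mul (1 - t)).add
      (hq.integrable_klFun.const_mul t)).mono' (measurable_klFun.comp hm).aestronglyMeasurable
      (ae_of_all _ fun z => ?_)
    rw [norm_of_nonneg (klFun_nonneg (add_nonneg (mul_nonneg (by linarith) (hp.nonneg z))
      (mul_nonneg ht0 (hq.nonneg z))))]
    exact convexOn_klFun.2 (hp.nonneg z) (hq.nonneg z) (by linarith) ht0 (by ring)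
  integral_eq v hv := by
    have h : ∀ z, v z * ((1 - t) * p z + t * q z) = (1 - t) * (v z * p z) + t * (v z * q z) :=
      fun z => by ring
    simp only [h]
    rw [integral_add ((hP.integrable_constraint_mul hp hv).const_mul _)
      ((hP.integrable_constraint_mul hq hv).const_mul _), integral_const_mul, integral_const_mul,
      hp.integral_eq v hv, hq.integral_eq v hv]
    ring

/-- The midpoint of p and q is admissible, so its energy is at least m; the cost is linear and
cancels, leaving the integrated gap of `klFun_midpoint_gap`. It yields both the Cauchy property of
minimizing sequences and uniqueness. -/
theorem IsEntropyProblem.integral_sqrt_sub_sq_le (hP : IsEntropyProblem ρ c W V)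
    (hp : IsAdmissibleDensity ρ c W V p) (hq : IsAdmissibleDensity ρ c W V q) {m : ℝ}
    (hm : ∀ r, IsAdmissibleDensity ρ c W V r → m ≤ energy ρ c r) :
    Integrable (fun z => (√(p z) - √(q z)) ^ 2) ρ ∧
    ∫ z, (√(p z) - √(q z)) ^ 2 ∂ρ ≤ 2 * (energy ρ c p - m) + 2 * (energy ρ c q - m) := by
  have hr := hP.admissible_convexComb hp hq (t := 1 / 2) (by norm_num) (by norm_num)
  have hle := hm _ hr
  have hint := (((hp.integrable_energy.add hq.integrable_energy).const_mul 2).sub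
    (hr.integrable_energy.const_mul 4))
  have hpt : ∀ z, (√(p z) - √(q z)) ^ 2 ≤
      2 * ((c z * p z + klFun (p z)) + (c z * q z + klFun (q z))) -
      4 * (c z * ((1 - 1 / 2) * p z + 1 / 2 * q z) + klFun ((1 - 1 / 2) * p z + 1 / 2 * q z)) := by
    intro z
    have h := klFun_midpoint_gap (hp.nonneg z) (hq.nonneg z)
    have h2 : (1 - 1 / 2) * p z + 1 / 2 * q z = (p z + q z) / 2 := by ring
    rw [h2]
    linarith
  have hint' : Integrable (fun z => (√(p z) - √(q z)) ^ 2) ρ := by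
    refine hint.mono' ((hp.measurable.sqrt.sub hq.measurable.sqrt).pow_const 2).aestronglyMeasurable
      (ae_of_all _ fun z => ?_)
    rw [norm_of_nonneg (sq_nonneg _)]
    exact hpt z
  refine ⟨hint', (integral_mono hint' hint hpt).trans ?_⟩
  have h1 := integral_sub (((hp.integrable_energy.add hq.integrable_energy).const_mul 2))
    (hr.integrable_energy.const_mul 4)
  have h2 := integral_add hp.integrable_energy hq.integrable_energy
  simp only [Pi.add_apply, integral_const_mul] at h1 h2
  simp only [energy] at *
  simp only [Pi.sub_apply, Pi.add_apply]
  rw [h1, h2]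
  linarith

end Minimization
end EntropicVQR

namespace EntropicVQR
open Filter Topology
open InformationTheory Real

/-! ### Existence of a minimizing density. -/

section Existence

variable {Ω : Type*} [MeasurableSpace Ω] {ρ : Measure Ω}

/-- Fatou's lemma, with integrability of the limit as part of the conclusion. -/
theorem integrable_of_tendsto_ae_of_integral_le {F : ℕ → Ω → ℝ} {f : Ω → ℝ} {K : ℕ → ℝ} {k : ℝ}
    (hF : ∀ n, Integrable (F n) ρ) (h0 : ∀ n z, 0 ≤ F n z) (hf : AEStronglyMeasurable f ρ)
    (hlim : ∀ᵐ z ∂ρ, Tendsto (fun n => F n z) atTop (𝓝 (f z)))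
    (hK : ∀ n, ∫ z, F n z ∂ρ ≤ K n) (hKk : Tendsto K atTop (𝓝 k)) :
    Integrable f ρ ∧ ∫ z, f z ∂ρ ≤ k := by
  have hf0 : 0 ≤ᵐ[ρ] f := by
    filter_upwards [hlim] with z hz
    exact ge_of_tendsto' hz fun n => h0 n z
  have hk0 : 0 ≤ k := ge_of_tendsto' hKk fun n => (integral_nonneg (h0 n)).trans (hK n)
  have hle : ∫⁻ z, ENNReal.ofReal (f z) ∂ρ ≤ ENNReal.ofReal k := by
    calc ∫⁻ z, ENNReal.ofReal (f z) ∂ρ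
        = ∫⁻ z, liminf (fun n => ENNReal.ofReal (F n z)) atTop ∂ρ := by
          refine lintegral_congr_ae ?_
          filter_upwards [hlim] with z hz
          exact (ENNReal.tendsto_ofReal hz).liminf_eq.symm
      _ ≤ liminf (fun n => ∫⁻ z, ENNReal.ofReal (F n z) ∂ρ) atTop :=
          lintegral_liminf_le' fun n => (hF n).aemeasurable.ennreal_ofReal
      _ ≤ liminf (fun n => ENNReal.ofReal (K n)) atTop := by
          refine liminf_le_liminf (Eventually.of_forall fun n => ?_)
          rw [← ofReal_integral_eq_lintegral_ofReal (hF n) (ae_of_all _ (h0 n))]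
          exact ENNReal.ofReal_le_ofReal (hK n)
      _ = ENNReal.ofReal k := (ENNReal.tendsto_ofReal hKk).liminf_eq
  have hint : Integrable f ρ :=
    (lintegral_ofReal_ne_top_iff_integrable hf hf0).1 (hle.trans_lt ENNReal.ofReal_lt_top).ne
  refine ⟨hint, ?_⟩
  rw [← ofReal_integral_eq_lintegral_ofReal hint hf0] at hle
  exact (ENNReal.ofReal_le_ofReal_iff hk0).1 hle

theorem integral_abs_mul_le_sqrt {f g : Ω → ℝ} (hf : MemLp f 2 ρ) (hg : MemLp g 2 ρ) :
    ∫ z, |f z| * |g z| ∂ρ ≤ √(∫ z, f z ^ 2 ∂ρ) * √(∫ z, g z ^ 2 ∂ρ) := by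
  have h := integral_mul_le_Lp_mul_Lq_of_nonneg (μ := ρ) (p := 2) (q := 2)
    Real.HolderConjugate.two_two (f := fun z => |f z|) (g := fun z => |g z|)
    (ae_of_all _ fun _ => abs_nonneg _) (ae_of_all _ fun _ => abs_nonneg _)
    (by simpa using hf.norm) (by simpa using hg.norm)
  simpa [sqrt_eq_rpow] using h

theorem norm_toLp_sub_sq {f g : Ω → ℝ} (hf : MemLp f 2 ρ) (hg : MemLp g 2 ρ) :
    ‖hf.toLp f - hg.toLp g‖ ^ 2 = ∫ z, (f z - g z) ^ 2 ∂ρ := by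
  rw [← real_inner_self_eq_norm_sq, L2.inner_def, ← MemLp.toLp_sub]
  refine integral_congr_ae ?_
  filter_upwards [(hf.sub hg).coeFn_toLp] with z hz
  rw [hz]
  simp [sq]

variable {c W : Ω → ℝ} {V : Submodule ℝ (Ω → ℝ)}
  {p q : Ω → ℝ}

theorem IsEntropyProblem.memLp_sqrt (hP : IsEntropyProblem ρ c W V)
    (hp : IsAdmissibleDensity ρ c W V p) : MemLp (fun z => √(p z)) 2 ρ := by
  rw [memLp_two_iff_integrable_sq hp.measurable.sqrt.aestronglyMeasurable]
  exact (hP.integrable_density hp).congr (ae_of_all _ fun z => (sq_sqrt (hp.nonneg z)).symm)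

/-- Square roots of a minimizing sequence of densities converge in `L²` along a subsequence. -/
theorem IsEntropyProblem.exists_minimizing_seq [IsProbabilityMeasure ρ]
    (hP : IsEntropyProblem ρ c W V) :
    ∃ (m : ℝ) (p : ℕ → Ω → ℝ) (s : Ω → ℝ),
      (∀ q, IsAdmissibleDensity ρ c W V q → m ≤ energy ρ c q) ∧
      (∀ n, IsAdmissibleDensity ρ c W V (p n)) ∧
      Tendsto (fun n => energy ρ c (p n)) atTop (𝓝 m) ∧
      Measurable s ∧ MemLp s 2 ρ ∧
      Tendsto (fun n => ∫ z, (√(p n z) - s z) ^ 2 ∂ρ) atTop (𝓝 0) ∧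
      ∀ᵐ z ∂ρ, Tendsto (fun n => √(p n z)) atTop (𝓝 (s z)) := by
  let A : Set ℝ := energy ρ c '' {q | IsAdmissibleDensity ρ c W V q}
  have hA : A.Nonempty := ⟨_, _, hP.admissible_one, rfl⟩
  have hbdd : BddBelow A := by
    refine ⟨0, ?_⟩
    rintro _ ⟨q, hq, rfl⟩
    exact integral_nonneg fun z => add_nonneg (mul_nonneg (hP.cost_nonneg z) (hq.nonneg z))
      (klFun_nonneg (hq.nonneg z))
  have hm : ∀ q, IsAdmissibleDensity ρ c W V q → sInf A ≤ energy ρ c q :=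
    fun q hq => csInf_le hbdd ⟨q, hq, rfl⟩
  have hex : ∀ n : ℕ, ∃ q, IsAdmissibleDensity ρ c W V q ∧
      energy ρ c q < sInf A + 1 / ((n : ℝ) + 1) := by
    intro n
    obtain ⟨_, ⟨q, hq, rfl⟩, h⟩ := exists_lt_of_csInf_lt hA
      (show sInf A < sInf A + 1 / ((n : ℝ) + 1) by
        have : (0 : ℝ) < 1 / ((n : ℝ) + 1) := by positivity
        linarith)
    exact ⟨q, hq, h⟩
  choose p hp hpe using hex
  let r : ℕ → Lp ℝ 2 ρ := fun n => (hP.memLp_sqrt (hp n)).toLp _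
  have hdist : ∀ n k, dist (r n) (r k) ^ 2 ≤ 2 * (1 / ((n : ℝ) + 1)) + 2 * (1 / ((k : ℝ) + 1)) := by
    intro n k
    rw [dist_eq_norm, norm_toLp_sub_sq]
    have := (hP.integral_sqrt_sub_sq_le (hp n) (hp k) hm).2
    linarith [hpe n, hpe k]
  have hcau : CauchySeq r := by
    refine Metric.cauchySeq_iff.2 fun δ hδ => ?_
    obtain ⟨N, hN⟩ := exists_nat_one_div_lt (show 0 < δ ^ 2 / 4 by positivity)
    refine ⟨N, fun n hn k hk => ?_⟩
    have h1 : 1 / ((n : ℝ) + 1) ≤ 1 / ((N : ℝ) + 1) := Nat.one_div_le_one_div hn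
    have h2 : 1 / ((k : ℝ) + 1) ≤ 1 / ((N : ℝ) + 1) := Nat.one_div_le_one_div hk
    exact lt_of_pow_lt_pow_left₀ 2 hδ.le (by linarith [hdist n k])
  obtain ⟨s, hs⟩ := cauchySeq_tendsto_of_complete hcau
  obtain ⟨ns, hmono, hns⟩ := (tendstoInMeasure_of_tendsto_Lp hs).exists_seq_tendsto_ae
  have hsm := Lp.memLp s
  refine ⟨sInf A, fun n => p (ns n), s, hm, fun n => hp _, ?_, (Lp.stronglyMeasurable s).measurable,
    hsm, ?_, ?_⟩
  · have hlim : Tendsto (fun n : ℕ => sInf A + 1 / ((n : ℝ) + 1)) atTop (𝓝 (sInf A)) := by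
      simpa using tendsto_one_div_add_atTop_nhds_zero_nat.const_add (sInf A)
    exact (tendsto_of_tendsto_of_tendsto_of_le_of_le tendsto_const_nhds hlim
      (fun n => hm _ (hp n)) fun n => (hpe n).le).comp hmono.tendsto_atTop
  · have h := ((tendsto_iff_norm_sub_tendsto_zero.1 hs).pow 2).comp hmono.tendsto_atTop
    rw [zero_pow two_ne_zero] at h
    refine h.congr fun n => ?_
    rw [← norm_toLp_sub_sq (hP.memLp_sqrt (hp (ns n))) hsm, Lp.toLp_coeFn]
    rfl
  · have hcoe := ae_all_iff.2 fun n => (hP.memLp_sqrt (hp (ns n))).coeFn_toLp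
    filter_upwards [hns, hcoe] with z h1 h2
    exact h1.congr h2

/-- Fatou handles energy and second moment. For a constraint v, write v pₙ - v s² = v (√pₙ - s)(√pₙ
+ s): the middle factor tends to 0 in L², while W (√pₙ + s) stays bounded in L². -/
theorem IsEntropyProblem.exists_minimizer [IsProbabilityMeasure ρ]
    (hP : IsEntropyProblem ρ c W V) :
    ∃ p, IsAdmissibleDensity ρ c W V p ∧
      ∀ q, IsAdmissibleDensity ρ c W V q → energy ρ c p ≤ energy ρ c q := by
  obtain ⟨m, p, s, hm, hp, hlim, hs, hs2, hps, hae⟩ := hP.exists_minimizing_seq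
  have hpae : ∀ᵐ z ∂ρ, Tendsto (fun n => p n z) atTop (𝓝 (s z ^ 2)) := by
    filter_upwards [hae] with z hz
    exact (hz.pow 2).congr fun n => sq_sqrt ((hp n).nonneg z)
  have hsm : Measurable fun z => s z ^ 2 := hs.pow_const 2
  have hem : Measurable fun z => c z * s z ^ 2 + klFun (s z ^ 2) :=
    (hP.measurable_cost.mul hsm).add (measurable_klFun.comp hsm)
  obtain ⟨hei, hel⟩ := integrable_of_tendsto_ae_of_integral_le
    (f := fun z => c z * s z ^ 2 + klFun (s z ^ 2)) (fun n => (hp n).integrable_energy)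
    (fun n z => add_nonneg (mul_nonneg (hP.cost_nonneg z) ((hp n).nonneg z))
      (klFun_nonneg ((hp n).nonneg z))) hem.aestronglyMeasurable
    (by
      filter_upwards [hpae] with z hz
      exact (hz.const_mul _).add ((continuous_klFun.tendsto _).comp hz))
    (fun n => le_rfl) hlim
  obtain ⟨hWi, hWl⟩ := integrable_of_tendsto_ae_of_integral_le
    (f := fun z => W z ^ 2 * s z ^ 2) (fun n => (hp n).integrable_weight)
    (fun n z => mul_nonneg (sq_nonneg _) ((hp n).nonneg z))
    ((hP.measurable_weight.pow_const 2).mul hsm).aestronglyMeasurable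
    (by
      filter_upwards [hpae] with z hz
      exact hz.const_mul _)
    (fun n => hP.integral_weight_le _ (hp n)) tendsto_const_nhds
  have hc0 : ∀ z, 0 ≤ c z * s z ^ 2 := fun z => mul_nonneg (hP.cost_nonneg z) (sq_nonneg _)
  have hk0 : ∀ z, 0 ≤ klFun (s z ^ 2) := fun z => klFun_nonneg (sq_nonneg _)
  refine ⟨fun z => s z ^ 2, ⟨hsm, fun z => sq_nonneg _, hWi, ?_, ?_, ?_⟩, fun q hq =>
    hel.trans (hm q hq)⟩
  · refine hei.mono' (hP.measurable_cost.mul hsm).aestronglyMeasurable (ae_of_all _ fun z => ?_)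
    rw [norm_of_nonneg (hc0 z)]
    linarith [hk0 z]
  · refine hei.mono' (measurable_klFun.comp hsm).aestronglyMeasurable (ae_of_all _ fun z => ?_)
    rw [norm_of_nonneg (hk0 z)]
    linarith [hc0 z]
  · intro v hv
    obtain ⟨C, hC⟩ := hP.bound_constraint v hv
    set B := ∫ z, W z ^ 2 ∂ρ
    have hbound : ∀ n, ‖∫ z, v z ∂ρ - ∫ z, v z * s z ^ 2 ∂ρ‖ ≤
        |C| * (√(∫ z, (√(p n z) - s z) ^ 2 ∂ρ) * √(4 * B)) := by
      intro n
      have hi1 := hP.integrable_constraint_mul (hp n) hv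
      have hi2 := hP.integrable_constraint_mul_of_weight hsm (fun z => sq_nonneg (s z)) hWi hv
      have hd : MemLp (fun z => √(p n z) - s z) 2 ρ := (hP.memLp_sqrt (hp n)).sub hs2
      have hgm : Measurable fun z => W z * (√(p n z) + s z) :=
        hP.measurable_weight.mul ((hp n).measurable.sqrt.add hs)
      have hgle : ∀ z, (W z * (√(p n z) + s z)) ^ 2 ≤
          2 * (W z ^ 2 * p n z) + 2 * (W z ^ 2 * s z ^ 2) := by
        intro z
        have := sq_sqrt ((hp n).nonneg z)
        have h2 : (√(p n z) + s z) ^ 2 ≤ 2 * p n z + 2 * s z ^ 2 := by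
          nlinarith [sq_nonneg (√(p n z) - s z)]
        nlinarith [mul_le_mul_of_nonneg_left h2 (sq_nonneg (W z))]
      have hdom := ((hp n).integrable_weight.const_mul 2).add (hWi.const_mul 2)
      have hgi : Integrable (fun z => (W z * (√(p n z) + s z)) ^ 2) ρ := by
        refine hdom.mono' (hgm.pow_const 2).aestronglyMeasurable (ae_of_all _ fun z => ?_)
        rw [norm_of_nonneg (sq_nonneg _)]
        exact hgle z
      have hg : MemLp (fun z => W z * (√(p n z) + s z)) 2 ρ :=
        (memLp_two_iff_integrable_sq hgm.aestronglyMeasurable).2 hgi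
      -- Both W² pₙ and W² s² have integral at most B, and each enters with the factor 2.
      have hgB : ∫ z, (W z * (√(p n z) + s z)) ^ 2 ∂ρ ≤ 4 * B := by
        refine (integral_mono hgi hdom hgle).trans ?_
        simp only [Pi.add_apply]
        rw [integral_add ((hp n).integrable_weight.const_mul 2) (hWi.const_mul 2),
          integral_const_mul, integral_const_mul]
        linarith [hP.integral_weight_le _ (hp n)]
      rw [← (hp n).integral_eq v hv, ← integral_sub hi1 hi2]
      calc ‖∫ z, (v z * p n z - v z * s z ^ 2) ∂ρ‖
          ≤ ∫ z, ‖v z * p n z - v z * s z ^ 2‖ ∂ρ := norm_integral_le_integral_norm _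
        _ ≤ ∫ z, |C| * (|√(p n z) - s z| * |W z * (√(p n z) + s z)|) ∂ρ := by
            refine integral_mono (hi1.sub hi2).norm ((hd.abs.integrable_mul hg.abs).const_mul _)
              fun z => ?_
            have h1 : v z * p n z - v z * s z ^ 2
                = v z * ((√(p n z) - s z) * (√(p n z) + s z)) := by
              nth_rewrite 1 [← sq_sqrt ((hp n).nonneg z)]
              ring
            have hW := hP.one_le_weight z
            have h2 : |v z| ≤ |C| * |W z| := (hC z).trans ((le_abs_self _).trans_eq (abs_mul _ _))
            simp only [h1, norm_eq_abs, abs_mul]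
            calc |v z| * (|√(p n z) - s z| * |√(p n z) + s z|)
                ≤ |C| * |W z| * (|√(p n z) - s z| * |√(p n z) + s z|) := by gcongr
              _ = _ := by ring
        _ ≤ |C| * (√(∫ z, (√(p n z) - s z) ^ 2 ∂ρ) * √(4 * B)) := by
            rw [integral_const_mul]
            refine mul_le_mul_of_nonneg_left ((integral_abs_mul_le_sqrt hd hg).trans ?_)
              (abs_nonneg C)
            exact mul_le_mul_of_nonneg_left (sqrt_le_sqrt hgB) (sqrt_nonneg _)
    have hz : Tendsto (fun n => |C| * (√(∫ z, (√(p n z) - s z) ^ 2 ∂ρ) * √(4 * B))) atTop (𝓝 0) := by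
      simpa using ((hps.sqrt).mul_const (√(4 * B))).const_mul |C|
    have := ge_of_tendsto' hz hbound
    exact (sub_eq_zero.1 (norm_le_zero_iff.1 this)).symm

end Existence
end EntropicVQR

namespace EntropicVQR
open Filter Topology
open InformationTheory Real

/-! ### Integration against a real density. -/

section WithDensity

variable {Ω : Type*} [MeasurableSpace Ω] {ρ : Measure Ω} {p : Ω → ℝ}

theorem integrable_withDensity_ofReal_iff (hp : Measurable p) (hp0 : ∀ z, 0 ≤ p z) {f : Ω → ℝ} :
    Integrable f (ρ.withDensity fun z => ENNReal.ofReal (p z)) ↔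
      Integrable (fun z => f z * p z) ρ := by
  have h := integrable_withDensity_iff_integrable_smul' (μ := ρ) hp.ennreal_ofReal
    (ae_of_all _ fun z => ENNReal.ofReal_lt_top) (g := f)
  simpa only [ENNReal.toReal_ofReal (hp0 _), smul_eq_mul, mul_comm] using h

theorem integral_withDensity_ofReal (hp : Measurable p) (hp0 : ∀ z, 0 ≤ p z) (f : Ω → ℝ) :
    ∫ z, f z ∂(ρ.withDensity fun z => ENNReal.ofReal (p z)) = ∫ z, f z * p z ∂ρ := by
  have h := integral_withDensity_eq_integral_toReal_smul (μ := ρ) hp.ennreal_ofReal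
    (ae_of_all _ fun z => ENNReal.ofReal_lt_top) f
  simpa only [ENNReal.toReal_ofReal (hp0 _), smul_eq_mul, mul_comm] using h

theorem isProbabilityMeasure_withDensity_ofReal (hp0 : ∀ z, 0 ≤ p z) (hpi : Integrable p ρ)
    (hp1 : ∫ z, p z ∂ρ = 1) :
    IsProbabilityMeasure (ρ.withDensity fun z => ENNReal.ofReal (p z)) := ⟨by
  rw [withDensity_apply _ MeasurableSet.univ, Measure.restrict_univ,
    ← ofReal_integral_eq_lintegral_ofReal hpi (ae_of_all _ hp0), hp1, ENNReal.ofReal_one]⟩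

end WithDensity

/-! ### Uniqueness, positivity and first-order conditions. -/

section Optimality

variable {Ω : Type*} [MeasurableSpace Ω] {ρ : Measure Ω} {c W : Ω → ℝ}
  {V : Submodule ℝ (Ω → ℝ)} {p q : Ω → ℝ}

/-- The minimizing density is unique. -/
theorem IsEntropyProblem.ae_eq_of_minimizer (hP : IsEntropyProblem ρ c W V)
    (hp : IsAdmissibleDensity ρ c W V p) (hq : IsAdmissibleDensity ρ c W V q)
    (hmin : ∀ r, IsAdmissibleDensity ρ c W V r → energy ρ c p ≤ energy ρ c r)
    (hpq : energy ρ c q ≤ energy ρ c p) : p =ᵐ[ρ] q := by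
  obtain ⟨hi, hle⟩ := hP.integral_sqrt_sub_sq_le hp hq hmin
  have h0 : ∫ z, (√(p z) - √(q z)) ^ 2 ∂ρ = 0 :=
    le_antisymm (by linarith) (integral_nonneg fun z => sq_nonneg _)
  filter_upwards [(integral_eq_zero_iff_of_nonneg (fun z => sq_nonneg _) hi).1 h0] with z hz
  have h1 : √(p z) = √(q z) := sub_eq_zero.1 (pow_eq_zero_iff two_ne_zero |>.1 hz)
  rwa [sqrt_inj (hp.nonneg z) (hq.nonneg z)] at h1

variable [IsProbabilityMeasure ρ]

/-- Move from p to x = (1 - t) p + t. The tangent to `klFun` at x gives t (p - 1) log x ≤ klFun p -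
klFun x, and minimality bounds the integrated right side by t ∫ c. The integrand is nonnegative
since x - 1 and p - 1 have the same sign. What matters is that the bound does not depend on t. -/
theorem IsEntropyProblem.integral_sub_one_mul_log_le (hP : IsEntropyProblem ρ c W V)
    (hp : IsAdmissibleDensity ρ c W V p)
    (hmin : ∀ r, IsAdmissibleDensity ρ c W V r → energy ρ c p ≤ energy ρ c r)
    {t : ℝ} (ht0 : 0 < t) (ht1 : t ≤ 1) :
    Integrable (fun z => (p z - 1) * log ((1 - t) * p z + t * 1)) ρ ∧
    ∫ z, (p z - 1) * log ((1 - t) * p z + t * 1) ∂ρ ≤ ∫ z, c z ∂ρ ∧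
    ∀ z, 0 ≤ (p z - 1) * log ((1 - t) * p z + t * 1) := by
  have hr := hP.admissible_convexComb hp hP.admissible_one ht0.le ht1
  have hle := hmin _ hr
  have hx0 : ∀ z, 0 < (1 - t) * p z + t * 1 := fun z => by
    have := mul_nonneg (sub_nonneg.2 ht1) (hp.nonneg z)
    linarith
  have hpos : ∀ z, 0 ≤ (p z - 1) * log ((1 - t) * p z + t * 1) := by
    intro z
    rcases le_total 1 (p z) with h | h
    · exact mul_nonneg (by linarith) (log_nonneg (by nlinarith))
    · exact mul_nonneg_of_nonpos_of_nonpos (by linarith) (log_nonpos (hx0 z).le (by nlinarith))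
  have hpt : ∀ z, (p z - 1) * log ((1 - t) * p z + t * 1) ≤
      t⁻¹ * (klFun (p z) - klFun ((1 - t) * p z + t * 1)) := by
    intro z
    have h := klFun_tangent_le (hp.nonneg z) (hx0 z)
    rw [le_inv_mul_iff₀ ht0]
    have h2 : p z - ((1 - t) * p z + t * 1) = t * (p z - 1) := by ring
    rw [h2] at h
    linarith
  have hdom := (hp.integrable_klFun.sub hr.integrable_klFun).const_mul t⁻¹
  have hint : Integrable (fun z => (p z - 1) * log ((1 - t) * p z + t * 1)) ρ := by
    refine hdom.mono' ((hp.measurable.sub_const 1).mul hr.measurable.log).aestronglyMeasurable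
      (ae_of_all _ fun z => ?_)
    rw [norm_of_nonneg (hpos z)]
    exact hpt z
  refine ⟨hint, (integral_mono hint hdom hpt).trans ?_, hpos⟩
  simp only [Pi.sub_apply]
  rw [integral_const_mul, integral_sub hp.integrable_klFun hr.integrable_klFun,
    inv_mul_le_iff₀ ht0]
  unfold energy at hle
  rw [integral_add hp.integrable_cost hp.integrable_klFun,
    integral_add hr.integrable_cost hr.integrable_klFun] at hle
  have hc : ∫ z, c z * ((1 - t) * p z + t * 1) ∂ρ
      = (1 - t) * ∫ z, c z * p z ∂ρ + t * ∫ z, c z ∂ρ := by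
    rw [← integral_const_mul, ← integral_const_mul,
      ← integral_add (hp.integrable_cost.const_mul _) (hP.integrable_cost.const_mul _)]
    congr 1 with z
    ring
  have hcp : 0 ≤ ∫ z, c z * p z ∂ρ :=
    integral_nonneg fun z => mul_nonneg (hP.cost_nonneg z) (hp.nonneg z)
  nlinarith

/-- The minimizing density is positive. -/
theorem IsEntropyProblem.ae_pos_of_minimizer (hP : IsEntropyProblem ρ c W V)
    (hp : IsAdmissibleDensity ρ c W V p)
    (hmin : ∀ r, IsAdmissibleDensity ρ c W V r → energy ρ c p ≤ energy ρ c r) :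
    ∀ᵐ z ∂ρ, 0 < p z := by
  let N : Set Ω := {z | p z = 0}
  have hN : MeasurableSet N := hp.measurable (measurableSet_singleton 0)
  set C := ∫ z, c z ∂ρ
  have hbound : ∀ n : ℕ, n * ρ.real N ≤ C := by
    intro n
    -- Where p = 0 the integrand is -log t, which equals n for this t.
    obtain ⟨hi, hle, hpos⟩ := hP.integral_sub_one_mul_log_le hp hmin (t := exp (-n)) (exp_pos _)
      (exp_le_one_iff.2 (by simp))
    calc (n : ℝ) * ρ.real N = ∫ z, N.indicator (fun _ => (n : ℝ)) z ∂ρ := by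
          rw [integral_indicator hN, setIntegral_const, smul_eq_mul, mul_comm]
      _ ≤ ∫ z, (p z - 1) * log ((1 - exp (-n)) * p z + exp (-n) * 1) ∂ρ := by
          refine integral_mono ((integrable_const _).indicator hN) hi fun z => ?_
          by_cases hz : z ∈ N
          · have hz' : p z = 0 := hz
            simp [hz, hz']
          · simpa [hz] using hpos z
      _ ≤ C := hle
  have hzero : ρ.real N = 0 := by
    by_contra hne
    have hpos : 0 < ρ.real N := lt_of_le_of_ne measureReal_nonneg (Ne.symm hne)
    obtain ⟨n, hn⟩ := exists_nat_gt (C / ρ.real N)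
    rw [div_lt_iff₀ hpos] at hn
    linarith [hbound n]
  have h0 : ∀ᵐ z ∂ρ, z ∉ N := measure_eq_zero_iff_ae_notMem.1 ((measureReal_eq_zero_iff).1 hzero)
  filter_upwards [h0] with z hz
  exact (hp.nonneg z).lt_of_ne fun h => hz h.symm

/-- The logarithm of the minimizing density is integrable. -/
theorem IsEntropyProblem.integrable_log_of_minimizer (hP : IsEntropyProblem ρ c W V)
    (hp : IsAdmissibleDensity ρ c W V p)
    (hmin : ∀ r, IsAdmissibleDensity ρ c W V r → energy ρ c p ≤ energy ρ c r) :
    Integrable (fun z => log (p z)) ρ := by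
  let t : ℕ → ℝ := fun n => 1 / ((n : ℝ) + 1)
  have ht0 : ∀ n, 0 < t n := fun n => by positivity
  have ht1 : ∀ n, t n ≤ 1 := fun n => by
    simpa [t] using Nat.one_div_le_one_div (α := ℝ) (Nat.zero_le n)
  have h := fun n => hP.integral_sub_one_mul_log_le hp hmin (ht0 n) (ht1 n)
  have hlim : Tendsto t atTop (𝓝 0) := tendsto_one_div_add_atTop_nhds_zero_nat
  -- As t → 0, Fatou makes (p - 1) log p integrable; subtracting it from p log p leaves log p.
  have hint := (integrable_of_tendsto_ae_of_integral_le (f := fun z => (p z - 1) * log (p z))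
    (fun n => (h n).1) (fun n => (h n).2.2)
    ((hp.measurable.sub_const 1).mul hp.measurable.log).aestronglyMeasurable
    (by
      filter_upwards [hP.ae_pos_of_minimizer hp hmin] with z hz
      refine Tendsto.const_mul _ (Tendsto.log ?_ hz.ne')
      simpa using ((hlim.const_sub 1).mul_const (p z)).add (hlim.mul_const 1))
    (fun n => (h n).2.1) tendsto_const_nhds).1
  refine ((hP.integrable_mul_log hp).sub hint).congr (ae_of_all _ fun z => ?_)
  simp only [Pi.sub_apply]
  ring

/-- A multiplicative perturbation keeps p nonnegative and its entropy finite, and `hkV` says exactly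
that the constraints do not move. -/
theorem IsEntropyProblem.admissible_perturb (hP : IsEntropyProblem ρ c W V)
    (hp : IsAdmissibleDensity ρ c W V p) {k : Ω → ℝ} (hk : Measurable k) (hk1 : ∀ z, |k z| ≤ 1)
    (hkV : ∀ v ∈ V, ∫ z, k z * (v z * p z) ∂ρ = 0) :
    IsAdmissibleDensity ρ c W V fun z => (1 + k z) * p z := by
  have hk0 : ∀ z, 0 ≤ 1 + k z := fun z => by linarith [neg_le_of_abs_le (hk1 z)]
  have hmul : ∀ {f : Ω → ℝ}, Integrable f ρ → Integrable (fun z => k z * f z) ρ := fun hf =>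
    hf.bdd_mul hk.aestronglyMeasurable (ae_of_all _ fun z => hk1 z)
  have hm : Measurable fun z => (1 + k z) * p z := (hk.const_add 1).mul hp.measurable
  refine ⟨hm, fun z => mul_nonneg (hk0 z) (hp.nonneg z), ?_, ?_, ?_, fun v hv => ?_⟩
  · refine (hp.integrable_weight.add (hmul hp.integrable_weight)).congr (ae_of_all _ fun z => ?_)
    simp only [Pi.add_apply]; ring
  · refine (hp.integrable_cost.add (hmul hp.integrable_cost)).congr (ae_of_all _ fun z => ?_)
    simp only [Pi.add_apply]; ring
  · have hdom := (hp.integrable_klFun.add (hmul (hP.integrable_mul_log hp))).add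
      (hmul (hmul (hP.integrable_density hp)))
    refine hdom.mono' (measurable_klFun.comp hm).aestronglyMeasurable (ae_of_all _ fun z => ?_)
    rw [norm_of_nonneg (klFun_nonneg (mul_nonneg (hk0 z) (hp.nonneg z)))]
    refine (klFun_mul_one_add_le (hp.nonneg z) (hk0 z)).trans_eq ?_
    simp only [Pi.add_apply]; ring
  · have h : ∀ z, v z * ((1 + k z) * p z) = v z * p z + k z * (v z * p z) := fun z => by ring
    simp only [h]
    have hi := hP.integrable_constraint_mul hp hv
    rw [integral_add hi (hmul hi), hkV v hv, add_zero, hp.integral_eq v hv]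

/-- First order optimality: bounded perturbations preserving the constraints do not change the
energy to first order. -/
theorem IsEntropyProblem.integral_mul_log_add_cost_eq_zero (hP : IsEntropyProblem ρ c W V)
    (hp : IsAdmissibleDensity ρ c W V p)
    (hmin : ∀ r, IsAdmissibleDensity ρ c W V r → energy ρ c p ≤ energy ρ c r)
    {k : Ω → ℝ} (hk : Measurable k) (hkb : ∃ M, ∀ z, |k z| ≤ M)
    (hkV : ∀ v ∈ V, ∫ z, k z * (v z * p z) ∂ρ = 0) :
    ∫ z, k z * (p z * log (p z) + c z * p z) ∂ρ = 0 := by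
  obtain ⟨M, hM⟩ := hkb
  have hM1 : 0 < |M| + 1 := by positivity
  have hkM : ∀ z, |k z| ≤ |M| + 1 := fun z => by linarith [hM z, le_abs_self M]
  have hG : Integrable (fun z => p z * log (p z) + c z * p z) ρ :=
    (hP.integrable_mul_log hp).add hp.integrable_cost
  have hmul : ∀ {f : Ω → ℝ}, Integrable f ρ → Integrable (fun z => k z * f z) ρ := fun hf =>
    hf.bdd_mul hk.aestronglyMeasurable (ae_of_all _ fun z => hM z)
  set I := ∫ z, k z * (p z * log (p z) + c z * p z) ∂ρ with hI
  set Q := ∫ z, k z * (k z * p z) ∂ρ with hQ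
  have hQi := hmul (hmul (hP.integrable_density hp))
  -- Minimality along (1 + t k) p: I is the first variation and Q bounds the quadratic remainder.
  have key : ∀ t : ℝ, |t| * (|M| + 1) ≤ 1 → 0 ≤ t * I + t ^ 2 * Q := by
    intro t ht
    have htk : ∀ z, |t * k z| ≤ 1 := fun z => by
      rw [abs_mul]
      exact (mul_le_mul_of_nonneg_left (hkM z) (abs_nonneg t)).trans ht
    have hr := hP.admissible_perturb hp (hk.const_mul t) htk fun v hv => by
      simp only [mul_assoc]
      rw [integral_const_mul, hkV v hv, mul_zero]
    have hle := hmin _ hr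
    have hA : Integrable (fun z => c z * p z + klFun (p z) +
        t * (k z * (p z * log (p z) + c z * p z))) ρ :=
      hp.integrable_energy.add ((hmul hG).const_mul t)
    have hdom := hA.add (hQi.const_mul (t ^ 2))
    have hup : energy ρ c (fun z => (1 + t * k z) * p z) ≤ energy ρ c p + t * I + t ^ 2 * Q := by
      refine (integral_mono hr.integrable_energy hdom fun z => ?_).trans_eq ?_
      · have h := klFun_mul_one_add_le (hp.nonneg z)
          (by linarith [neg_le_of_abs_le (htk z)] : 0 ≤ 1 + t * k z)
        simp only [Pi.add_apply]
        nlinarith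
      · simp only [Pi.add_apply]
        rw [integral_add hA (hQi.const_mul (t ^ 2)),
          integral_add hp.integrable_energy ((hmul hG).const_mul t), integral_const_mul,
          integral_const_mul]
        rfl
    linarith
  have hQ0 : 0 ≤ Q := integral_nonneg fun z => by
    have : k z * (k z * p z) = k z ^ 2 * p z := by ring
    simp only [Pi.zero_apply, this]
    exact mul_nonneg (sq_nonneg _) (hp.nonneg z)
  by_contra hne
  have hlt : 0 < |I| := abs_pos.2 hne
  -- The first entry keeps |t k| ≤ 1. The second gives t Q < |I|, so t I + t² Q is negative for t or
  -- for -t. `Q + 1` avoids division by zero.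
  let t : ℝ := min (1 / (|M| + 1)) (|I| / (2 * (Q + 1)))
  have ht : 0 < t := lt_min (by positivity) (by positivity)
  have ht1 : t * (|M| + 1) ≤ 1 := by
    rw [← le_div_iff₀ hM1]
    exact min_le_left _ _
  have ht2 : t * (2 * (Q + 1)) ≤ |I| := by
    rw [← le_div_iff₀ (by positivity)]
    exact min_le_right _ _
  have h1 := key t (by rwa [abs_of_pos ht])
  have h2 := key (-t) (by rwa [abs_neg, abs_of_pos ht])
  rcases abs_cases I with ⟨h, _⟩ | ⟨h, _⟩ <;> rw [h] at ht2 hlt <;> nlinarith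

/-- The logarithm of the minimizing density, plus the cost, is an almost everywhere limit of
constraint functions. -/
theorem IsEntropyProblem.exists_seq_tendsto_log_add_cost (hP : IsEntropyProblem ρ c W V)
    (hp : IsAdmissibleDensity ρ c W V p)
    (hmin : ∀ r, IsAdmissibleDensity ρ c W V r → energy ρ c p ≤ energy ρ c r) :
    ∃ v : ℕ → Ω → ℝ, (∀ n, v n ∈ V) ∧
      ∀ᵐ z ∂ρ, Tendsto (fun n => v n z) atTop (𝓝 (log (p z) + c z)) := by
  -- The approximation takes place in L¹(p dρ), where the first-order condition is an annihilator
  -- statement; p > 0 transfers null sets back to ρ.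
  let P := ρ.withDensity fun z => ENNReal.ofReal (p z)
  have hPp : IsProbabilityMeasure P := isProbabilityMeasure_withDensity_ofReal hp.nonneg
    (hP.integrable_density hp) (hP.integral_density hp)
  have hac : ρ ≪ P := by
    refine withDensity_absolutelyContinuous' hp.measurable.ennreal_ofReal.aemeasurable ?_
    filter_upwards [hP.ae_pos_of_minimizer hp hmin] with z hz
    exact (ENNReal.ofReal_pos.2 hz).ne'
  obtain ⟨v, hv, hlim⟩ := exists_seq_tendsto_ae_of_annihilator P V
    (fun v hv => (integrable_withDensity_ofReal_iff hp.measurable hp.nonneg).2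
      (hP.integrable_constraint_mul hp hv))
    (fun z => log (p z) + c z)
    ((integrable_withDensity_ofReal_iff hp.measurable hp.nonneg).2
      (((hP.integrable_mul_log hp).add hp.integrable_cost).congr
        (ae_of_all _ fun z => by simp only [Pi.add_apply]; ring)))
    (fun k hk hkb hkV => by
      rw [integral_withDensity_ofReal hp.measurable hp.nonneg]
      refine (integral_congr_ae (ae_of_all _ fun z => ?_)).trans
        (hP.integral_mul_log_add_cost_eq_zero hp hmin hk hkb fun v hv => ?_)
      · ring
      · rw [← hkV v hv, integral_withDensity_ofReal hp.measurable hp.nonneg]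
        refine integral_congr_ae (ae_of_all _ fun z => ?_)
        ring)
  exact ⟨v, hv, hac hlim⟩

end Optimality
end EntropicVQR

namespace EntropicVQR
open Filter Topology
open InformationTheory Real

/-! ### Recovering potentials from the nondegeneracy of (1, X). -/

section Nondegeneracy

variable {dx dy : ℕ} {μ : Measure (E dy)} {ν : Measure (E dx × E dy)}

theorem integrable_norm_fst_sq (hν : Integrable (fun w => ‖w.1‖ ^ 2 + ‖w.2‖ ^ 2) ν) :
    Integrable (fun w => ‖w.1‖ ^ 2) ν := by
  refine hν.mono' (by fun_prop) (ae_of_all _ fun w => ?_)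
  rw [norm_of_nonneg (sq_nonneg _)]
  linarith [sq_nonneg ‖w.2‖]

theorem integrable_norm_snd_sq (hν : Integrable (fun w => ‖w.1‖ ^ 2 + ‖w.2‖ ^ 2) ν) :
    Integrable (fun w => ‖w.2‖ ^ 2) ν := by
  refine hν.mono' (by fun_prop) (ae_of_all _ fun w => ?_)
  rw [norm_of_nonneg (sq_nonneg _)]
  linarith [sq_nonneg ‖w.1‖]

theorem integrable_fst [IsFiniteMeasure ν] (hν : Integrable (fun w => ‖w.1‖ ^ 2 + ‖w.2‖ ^ 2) ν) :
    Integrable (fun w => w.1) ν := by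
  refine ((integrable_norm_fst_sq hν).add (integrable_const 1)).mono'
    measurable_fst.aestronglyMeasurable (ae_of_all _ fun w => ?_)
  simp only [Pi.add_apply]
  nlinarith [sq_nonneg (‖w.1‖ - 1)]

/-- The vector `(1, X)` is not supported on a linear hyperplane. -/
theorem eq_zero_of_ae_inner_add_eq_zero [IsProbabilityMeasure ν]
    (hν : Integrable (fun w => ‖w.1‖ ^ 2 + ‖w.2‖ ^ 2) ν) (hmean : ∫ w, w.1 ∂ν = 0)
    (hinv : IsUnit (secondMoment ν)) {a : E dx} {b : ℝ}
    (h : ∀ᵐ w ∂ν, inner ℝ a w.1 + b = 0) : a = 0 ∧ b = 0 := by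
  have hx := integrable_fst hν
  have hb : b = 0 := by
    have h1 : ∫ w, (inner ℝ a w.1 + b) ∂ν = 0 := integral_eq_zero_of_ae h
    rw [integral_add (hx.const_inner a) (integrable_const b), integral_inner hx, hmean] at h1
    simpa using h1
  subst hb
  refine ⟨?_, rfl⟩
  have hij : ∀ i j : Fin dx, Integrable (fun w => w.1 i * w.1 j) ν := by
    intro i j
    refine (integrable_norm_fst_sq hν).mono' (by fun_prop) (ae_of_all _ fun w => ?_)
    rw [norm_mul, sq]
    exact mul_le_mul (PiLp.norm_apply_le _ _) (PiLp.norm_apply_le _ _) (norm_nonneg _)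
      (norm_nonneg _)
  -- Multiply ⟨a, X⟩ = 0 by each coordinate of X and integrate.
  have hz : (secondMoment ν).mulVec a.ofLp = 0 := by
    ext i
    have h2 : ∫ w, w.1 i * inner ℝ a w.1 ∂ν = 0 := by
      refine integral_eq_zero_of_ae ?_
      filter_upwards [h] with w hw
      rw [add_zero] at hw
      simp [hw]
    rw [Pi.zero_apply, ← h2]
    simp only [Matrix.mulVec, dotProduct, secondMoment, Matrix.of_apply, PiLp.inner_apply,
      Finset.mul_sum]
    rw [integral_finsetSum]
    · refine Finset.sum_congr rfl fun j _ => ?_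
      rw [← integral_mul_const]
      refine integral_congr_ae (ae_of_all _ fun w => ?_)
      simp only [RCLike.inner_apply, conj_trivial]
      ring
    · intro j _
      refine ((hij i j).mul_const (a j)).congr (ae_of_all _ fun w => ?_)
      simp only [RCLike.inner_apply, conj_trivial]
      ring
  have := Matrix.mulVec_injective_of_isUnit hinv (hz.trans (Matrix.mulVec_zero _).symm)
  ext i
  exact congrFun this i

/-- A subspace containing `(1, X)` almost surely is the whole space. -/
theorem submodule_eq_top_of_ae_mem [IsProbabilityMeasure ν]
    (hν : Integrable (fun w => ‖w.1‖ ^ 2 + ‖w.2‖ ^ 2) ν) (hmean : ∫ w, w.1 ∂ν = 0)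
    (hinv : IsUnit (secondMoment ν)) (S : Submodule ℝ (ℝ × E dx))
    (h : ∀ᵐ w ∂ν, ((1 : ℝ), w.1) ∈ S) : S = ⊤ := by
  by_contra hne
  obtain ⟨φ, hφ, hS⟩ := S.exists_le_ker_of_lt_top (lt_top_iff_ne_top.2 hne)
  let T : StrongDual ℝ (E dx) := (φ.comp (LinearMap.inr ℝ ℝ (E dx))).toContinuousLinearMap
  let a : E dx := (InnerProductSpace.toDual ℝ (E dx)).symm T
  have ha : ∀ x, inner ℝ a x = φ (0, x) := fun x => InnerProductSpace.toDual_symm_apply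
  have hsplit : ∀ y : ℝ × E dx, φ y = inner ℝ a y.2 + y.1 * φ (1, 0) := by
    intro y
    rw [ha, ← smul_eq_mul, ← map_smul, ← map_add]
    simp
  have h0 : ∀ᵐ w ∂ν, inner ℝ a w.1 + φ (1, 0) = 0 := by
    filter_upwards [h] with w hw
    have := hS hw
    rw [LinearMap.mem_ker, hsplit] at this
    simpa using this
  obtain ⟨ha0, hb0⟩ := eq_zero_of_ae_inner_add_eq_zero hν hmean hinv h0
  refine hφ (LinearMap.ext fun y => ?_)
  rw [hsplit, ha0, hb0]
  simp

/-- Affine functions converging `ν`-almost everywhere have convergent coefficients. -/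
theorem exists_tendsto_of_ae_exists_tendsto [IsProbabilityMeasure ν]
    (hν : Integrable (fun w => ‖w.1‖ ^ 2 + ‖w.2‖ ^ 2) ν) (hmean : ∫ w, w.1 ∂ν = 0)
    (hinv : IsUnit (secondMoment ν)) {a : ℕ → E dx} {b : ℕ → ℝ}
    (h : ∀ᵐ w ∂ν, ∃ l, Tendsto (fun n => b n + inner ℝ (a n) w.1) atTop (𝓝 l)) :
    (∃ l, Tendsto a atTop (𝓝 l)) ∧ ∃ l, Tendsto b atTop (𝓝 l) := by
  -- The directions (t, x) along which bₙ t + ⟨aₙ, x⟩ converges form a subspace, and it contains (1,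
  -- X) almost surely.
  let S : Submodule ℝ (ℝ × E dx) :=
    { carrier := {y | ∃ l, Tendsto (fun n => b n * y.1 + inner ℝ (a n) y.2) atTop (𝓝 l)}
      add_mem' := by
        rintro y z ⟨l, hl⟩ ⟨k, hk⟩
        refine ⟨l + k, (hl.add hk).congr fun n => ?_⟩
        rw [Prod.fst_add, Prod.snd_add, inner_add_right]
        ring
      zero_mem' := ⟨0, by simp⟩
      smul_mem' := by
        rintro t y ⟨l, hl⟩
        refine ⟨t * l, (hl.const_mul t).congr fun n => ?_⟩
        rw [Prod.smul_fst, Prod.smul_snd, inner_smul_right, smul_eq_mul]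
        ring }
  have hS : S = ⊤ := submodule_eq_top_of_ae_mem hν hmean hinv S (by
    filter_upwards [h] with w hw
    simpa [S] using hw)
  have hmem : ∀ y, y ∈ S := fun y => hS ▸ Submodule.mem_top
  constructor
  · have hi : ∀ i, ∃ l, Tendsto (fun n => inner ℝ (EuclideanSpace.basisFun (Fin dx) ℝ i) (a n))
        atTop (𝓝 l) := fun i => by
      obtain ⟨l, hl⟩ := hmem (0, EuclideanSpace.basisFun (Fin dx) ℝ i)
      refine ⟨l, hl.congr fun n => ?_⟩
      rw [mul_zero, zero_add, real_inner_comm]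
    choose l hl using hi
    refine ⟨∑ i, l i • EuclideanSpace.basisFun (Fin dx) ℝ i, ?_⟩
    refine (tendsto_finsetSum _ fun i _ => (hl i).smul_const
      (EuclideanSpace.basisFun (Fin dx) ℝ i)).congr fun n => ?_
    exact (EuclideanSpace.basisFun (Fin dx) ℝ).sum_repr' (a n)
  · obtain ⟨l, hl⟩ := hmem (1, 0)
    exact ⟨l, by simpa using hl⟩

/-- Almost everywhere limits of functions `f(u) + ⟨g(u), x⟩ + h(x, y)` are of the same form. -/
theorem exists_eq_add_inner_add_of_tendsto [IsProbabilityMeasure μ] [IsProbabilityMeasure ν]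
    (hν : Integrable (fun w => ‖w.1‖ ^ 2 + ‖w.2‖ ^ 2) ν) (hmean : ∫ w, w.1 ∂ν = 0)
    (hinv : IsUnit (secondMoment ν)) {f : ℕ → E dy → ℝ} {g : ℕ → E dy → E dx}
    {h : ℕ → E dx × E dy → ℝ} (hf : ∀ n, Measurable (f n)) (hg : ∀ n, Measurable (g n))
    (hh : ∀ n, Measurable (h n)) {F : Z dx dy → ℝ}
    (hlim : ∀ᵐ z ∂(μ.prod ν),
      Tendsto (fun n => f n z.1 + inner ℝ (g n z.1) z.2.1 + h n z.2) atTop (𝓝 (F z))) :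
    ∃ (f' : E dy → ℝ) (g' : E dy → E dx) (h' : E dx × E dy → ℝ),
      Measurable f' ∧ Measurable g' ∧ Measurable h' ∧
      ∀ᵐ z ∂(μ.prod ν), F z = f' z.1 + inner ℝ (g' z.1) z.2.1 + h' z.2 := by
  have hae := Measure.ae_ae_of_ae_prod hlim
  -- The splitting into potentials is not unique, so fₙ and gₙ need not converge. Subtracting the
  -- slice at a generic u₀ removes hₙ and makes the differences converge; the slice itself becomes
  -- the new h.
  obtain ⟨u₀, hu₀⟩ := hae.exists
  have hconv : ∀ᵐ u ∂μ, (∃ l, Tendsto (fun n => g n u - g n u₀) atTop (𝓝 l)) ∧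
      ∃ l, Tendsto (fun n => f n u - f n u₀) atTop (𝓝 l) := by
    filter_upwards [hae] with u hu
    refine exists_tendsto_of_ae_exists_tendsto hν hmean hinv ?_
    filter_upwards [hu, hu₀] with w h1 h2
    refine ⟨_, (h1.sub h2).congr fun n => ?_⟩
    rw [inner_sub_left]
    ring
  obtain ⟨f', hf'm, hf'⟩ := measurable_limit_of_tendsto_metrizable_ae (μ := μ)
    (fun n => ((hf n).sub_const (f n u₀)).aemeasurable) (hconv.mono fun u hu => hu.2)
  obtain ⟨g', hg'm, hg'⟩ := measurable_limit_of_tendsto_metrizable_ae (μ := μ)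
    (fun n => ((hg n).sub_const (g n u₀)).aemeasurable) (hconv.mono fun u hu => hu.1)
  have hhm : ∀ n, Measurable fun w : E dx × E dy => f n u₀ + inner ℝ (g n u₀) w.1 + h n w :=
    fun n => ((measurable_fst.const_inner).const_add _).add (hh n)
  obtain ⟨h', hh'm, hh'⟩ := measurable_limit_of_tendsto_metrizable_ae (μ := ν)
    (fun n => (hhm n).aemeasurable) (hu₀.mono fun w hw => ⟨_, hw⟩)
  refine ⟨f', g', h', hf'm, hg'm, hh'm, ?_⟩
  filter_upwards [hlim, Measure.quasiMeasurePreserving_fst.ae hf',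
    Measure.quasiMeasurePreserving_fst.ae hg', Measure.quasiMeasurePreserving_snd.ae hh']
    with z h0 h1 h2 h3
  refine tendsto_nhds_unique h0 (((h1.add (h2.inner tendsto_const_nhds)).add h3).congr fun n => ?_)
  rw [inner_sub_left]
  ring

/-- If `f(u) + ⟨g(u), x⟩ + h(x, y)` is integrable for the product measure then so are `f`, `g` and
`h`. -/
theorem integrable_of_integrable_add_inner_add [IsProbabilityMeasure μ] [IsProbabilityMeasure ν]
    (hν : Integrable (fun w => ‖w.1‖ ^ 2 + ‖w.2‖ ^ 2) ν) (hmean : ∫ w, w.1 ∂ν = 0)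
    (hinv : IsUnit (secondMoment ν)) {f : E dy → ℝ} {g : E dy → E dx} {h : E dx × E dy → ℝ}
    (hF : Integrable (fun z : Z dx dy => f z.1 + inner ℝ (g z.1) z.2.1 + h z.2) (μ.prod ν)) :
    Integrable f μ ∧ Integrable g μ ∧ Integrable h ν := by
  have hh : Integrable h ν := by
    obtain ⟨u, hu⟩ := hF.prod_right_ae.exists
    refine ((hu.sub (integrable_const (f u))).sub ((integrable_fst hν).const_inner (g u))).congr
      (ae_of_all _ fun w => ?_)
    simp only [Pi.sub_apply]
    ring
  have hG : Integrable (fun z : Z dx dy => f z.1 + inner ℝ (g z.1) z.2.1) (μ.prod ν) := by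
    refine (hF.sub (hh.comp_snd μ)).congr (ae_of_all _ fun z => ?_)
    simp only [Pi.sub_apply]
    ring
  -- The same device, with integrability in place of convergence.
  let S : Submodule ℝ (ℝ × E dx) :=
    { carrier := {y | Integrable (fun u => f u * y.1 + inner ℝ (g u) y.2) μ}
      add_mem' := by
        intro y z hy hz
        refine (Integrable.add hy hz).congr (ae_of_all _ fun u => ?_)
        simp only [Pi.add_apply, Prod.fst_add, Prod.snd_add, inner_add_right]
        ring
      zero_mem' := by simp
      smul_mem' := by
        intro t y hy
        refine (Integrable.const_mul hy t).congr (ae_of_all _ fun u => ?_)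
        simp only [Prod.smul_fst, Prod.smul_snd, inner_smul_right, smul_eq_mul]
        ring }
  have hS : S = ⊤ := submodule_eq_top_of_ae_mem hν hmean hinv S (by
    filter_upwards [hG.prod_left_ae] with w hw
    simpa [S] using hw)
  have hmem : ∀ y, y ∈ S := fun y => hS ▸ Submodule.mem_top
  refine ⟨by simpa [S] using hmem (1, 0), ?_, hh⟩
  refine (integrable_finsetSum Finset.univ fun i _ =>
    (show Integrable (fun u => inner ℝ (EuclideanSpace.basisFun (Fin dx) ℝ i) (g u)) μ from ?_).smul_const
      (EuclideanSpace.basisFun (Fin dx) ℝ i)).congr (ae_of_all _ fun u => ?_)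
  · refine Integrable.congr (hmem (0, EuclideanSpace.basisFun (Fin dx) ℝ i))
      (ae_of_all _ fun u => ?_)
    simp only
    rw [mul_zero, zero_add, real_inner_comm]
  · exact (EuclideanSpace.basisFun (Fin dx) ℝ).sum_repr' (g u)

end Nondegeneracy
end EntropicVQR

namespace EntropicVQR
open Filter Topology
open Real (norm_eq_abs norm_of_nonneg)

/-! ### Feasibility as linear constraints. -/

section Feasibility

variable {dx dy : ℕ} {μ : Measure (E dy)} {ν : Measure (E dx × E dy)}

/-- The functions `f(u) + ⟨g(u), x⟩ + h(x, y)` with bounded measurable `f`, `g` and `h`. -/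
def constraintSpace (dx dy : ℕ) : Submodule ℝ (Z dx dy → ℝ) where
  carrier := {v | ∃ (f : E dy → ℝ) (g : E dy → E dx) (h : E dx × E dy → ℝ),
    (Measurable f ∧ Measurable g ∧ Measurable h) ∧
    (∃ M, (∀ u, |f u| ≤ M) ∧ (∀ u, ‖g u‖ ≤ M) ∧ ∀ w, |h w| ≤ M) ∧
    v = fun z => f z.1 + inner ℝ (g z.1) z.2.1 + h z.2}
  add_mem' := by
    rintro _ _ ⟨f, g, h, ⟨hf, hg, hh⟩, ⟨M, hM1, hM2, hM3⟩, rfl⟩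
      ⟨f', g', h', ⟨hf', hg', hh'⟩, ⟨M', hM1', hM2', hM3'⟩, rfl⟩
    refine ⟨f + f', g + g', h + h', ⟨hf.add hf', hg.add hg', hh.add hh'⟩, ⟨M + M',
      fun u => (abs_add_le _ _).trans (add_le_add (hM1 u) (hM1' u)),
      fun u => (norm_add_le _ _).trans (add_le_add (hM2 u) (hM2' u)),
      fun w => (abs_add_le _ _).trans (add_le_add (hM3 w) (hM3' w))⟩, ?_⟩
    ext z
    simp only [Pi.add_apply, inner_add_left]
    ring
  zero_mem' := ⟨0, 0, 0, ⟨measurable_zero, measurable_zero, measurable_zero⟩,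
    ⟨0, by simp⟩, by ext z; simp⟩
  smul_mem' := by
    rintro t _ ⟨f, g, h, ⟨hf, hg, hh⟩, ⟨M, hM1, hM2, hM3⟩, rfl⟩
    refine ⟨t • f, t • g, t • h, ⟨hf.const_smul t, hg.const_smul t, hh.const_smul t⟩,
      ⟨|t| * M, fun u => ?_, fun u => ?_, fun w => ?_⟩, ?_⟩
    · rw [Pi.smul_apply, smul_eq_mul, abs_mul]
      exact mul_le_mul_of_nonneg_left (hM1 u) (abs_nonneg t)
    · rw [Pi.smul_apply, norm_smul]
      exact mul_le_mul_of_nonneg_left (hM2 u) (abs_nonneg t)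
    · rw [Pi.smul_apply, smul_eq_mul, abs_mul]
      exact mul_le_mul_of_nonneg_left (hM3 w) (abs_nonneg t)
    · ext z
      simp only [Pi.smul_apply, inner_smul_left, smul_eq_mul, conj_trivial]
      ring

/-- The weight `1 + ‖x‖`. -/
noncomputable def weight {dx dy : ℕ} (z : Z dx dy) : ℝ := 1 + ‖z.2.1‖

theorem measurable_weight : Measurable (weight : Z dx dy → ℝ) := by
  unfold weight
  fun_prop

theorem measurable_cost : Measurable (cost : Z dx dy → ℝ) := by
  unfold cost
  fun_prop

theorem cost_nonneg (z : Z dx dy) : 0 ≤ cost z := by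
  unfold cost
  positivity

theorem measurable_of_mem_constraintSpace {v : Z dx dy → ℝ} (hv : v ∈ constraintSpace dx dy) :
    Measurable v := by
  obtain ⟨f, g, h, ⟨hf, hg, hh⟩, -, rfl⟩ := hv
  fun_prop

theorem exists_abs_le_mul_weight {v : Z dx dy → ℝ} (hv : v ∈ constraintSpace dx dy) :
    ∃ C, ∀ z, |v z| ≤ C * weight z := by
  obtain ⟨f, g, h, -, ⟨M, hM1, hM2, hM3⟩, rfl⟩ := hv
  refine ⟨2 * M, fun z => ?_⟩
  have hM : 0 ≤ M := (abs_nonneg _).trans (hM1 z.1)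
  have h1 : |inner ℝ (g z.1) z.2.1| ≤ M * ‖z.2.1‖ :=
    (abs_real_inner_le_norm _ _).trans (mul_le_mul_of_nonneg_right (hM2 _) (norm_nonneg _))
  have h2 : 0 ≤ M * ‖z.2.1‖ := mul_nonneg hM (norm_nonneg _)
  calc |f z.1 + inner ℝ (g z.1) z.2.1 + h z.2|
      ≤ |f z.1| + |inner ℝ (g z.1) z.2.1| + |h z.2| := abs_add_three _ _ _
    _ ≤ M + M * ‖z.2.1‖ + M := by linarith [hM1 z.1, hM3 z.2]
    _ ≤ 2 * M * weight z := by unfold weight; linarith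

theorem comp_fst_mem_constraintSpace {f : E dy → ℝ} (hf : Measurable f) {M : ℝ}
    (hM : ∀ u, |f u| ≤ M) : (fun z : Z dx dy => f z.1) ∈ constraintSpace dx dy := by
  have h0 : 0 ≤ M := (abs_nonneg _).trans (hM 0)
  exact ⟨f, 0, 0, ⟨hf, measurable_zero, measurable_zero⟩, ⟨M, hM, by simpa, by simpa⟩,
    by ext z; simp⟩

theorem comp_snd_mem_constraintSpace {h : E dx × E dy → ℝ} (hh : Measurable h) {M : ℝ}
    (hM : ∀ w, |h w| ≤ M) : (fun z : Z dx dy => h z.2) ∈ constraintSpace dx dy := by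
  have h0 : 0 ≤ M := (abs_nonneg _).trans (hM 0)
  exact ⟨0, 0, h, ⟨measurable_zero, measurable_zero, hh⟩, ⟨M, by simpa, by simpa, hM⟩,
    by ext z; simp⟩

theorem inner_mem_constraintSpace {g : E dy → E dx} (hg : Measurable g) {M : ℝ}
    (hM : ∀ u, ‖g u‖ ≤ M) :
    (fun z : Z dx dy => inner ℝ (g z.1) z.2.1) ∈ constraintSpace dx dy := by
  have h0 : 0 ≤ M := (norm_nonneg _).trans (hM 0)
  exact ⟨0, g, 0, ⟨measurable_zero, hg, measurable_zero⟩, ⟨M, by simpa, hM, by simpa⟩,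
    by ext z; simp⟩

theorem isCoupling_prod [IsProbabilityMeasure μ] [IsProbabilityMeasure ν] :
    IsCoupling (μ.prod ν) μ ν := by
  constructor
  · rw [Measure.map_fst_prod]; simp
  · rw [Measure.map_snd_prod]; simp

section Coupling

variable {A B : Type*} [MeasurableSpace A] [MeasurableSpace B] {γ : Measure (A × B)}
  {P : Measure A} {Q : Measure B}

theorem IsCoupling.integrable_fst (hγ : IsCoupling γ P Q) {f : A → ℝ} (hf : Integrable f P) :
    Integrable (fun z => f z.1) γ :=
  Integrable.comp_measurable (by rwa [hγ.1]) measurable_fst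

theorem IsCoupling.integrable_snd (hγ : IsCoupling γ P Q) {F : Type*} [NormedAddCommGroup F]
    {f : B → F} (hf : Integrable f Q) :
    Integrable (fun z => f z.2) γ :=
  Integrable.comp_measurable (by rwa [hγ.2]) measurable_snd

theorem IsCoupling.integral_fst (hγ : IsCoupling γ P Q) {f : A → ℝ} (hf : Integrable f P) :
    ∫ z, f z.1 ∂γ = ∫ u, f u ∂P := by
  have h := hγ.1
  rw [← h] at hf ⊢
  exact (integral_map measurable_fst.aemeasurable hf.aestronglyMeasurable).symm

theorem IsCoupling.integral_snd (hγ : IsCoupling γ P Q) {f : B → ℝ} (hf : Integrable f Q) :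
    ∫ z, f z.2 ∂γ = ∫ w, f w ∂Q := by
  have h := hγ.2
  rw [← h] at hf ⊢
  exact (integral_map measurable_snd.aemeasurable hf.aestronglyMeasurable).symm

end Coupling

variable {π : ProbabilityMeasure (Z dx dy)}

theorem Feasible.fst_eq (hπ : Feasible μ ν π) : (π : Measure (Z dx dy)).fst = μ := hπ.1.1

theorem Feasible.ae_integral_inner_eq_zero [IsFiniteMeasure ν] (hπ : Feasible μ ν π)
    (hν : Integrable (fun w => ‖w.1‖ ^ 2 + ‖w.2‖ ^ 2) ν) (g : E dy → E dx) :
    ∀ᵐ u ∂μ, Integrable (fun w => inner ℝ (g u) w.1) ((π : Measure (Z dx dy)).condKernel u) ∧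
      ∫ w, inner ℝ (g u) w.1 ∂((π : Measure (Z dx dy)).condKernel u) = 0 := by
  have hx := hπ.1.integrable_snd (integrable_fst hν)
  have hx' := hx.condKernel_ae
  rw [hπ.fst_eq] at hx'
  filter_upwards [hx', hπ.2] with u h1 h2
  exact ⟨h1.const_inner _, by rw [integral_inner h1, h2, inner_zero_right]⟩

theorem Feasible.integral_inner_eq_zero [IsFiniteMeasure ν] (hπ : Feasible μ ν π)
    (hν : Integrable (fun w => ‖w.1‖ ^ 2 + ‖w.2‖ ^ 2) ν) {g : E dy → E dx}
    (hg : Integrable (fun z : Z dx dy => inner ℝ (g z.1) z.2.1) (π : Measure (Z dx dy))) :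
    ∫ z, inner ℝ (g z.1) z.2.1 ∂(π : Measure (Z dx dy)) = 0 := by
  rw [← Measure.integral_condKernel hg, hπ.fst_eq]
  exact integral_eq_zero_of_ae ((hπ.ae_integral_inner_eq_zero hν g).mono fun u hu => hu.2)

/-- Since |s| = 2 s⁺ - s and ⟨g(u), x⟩ has conditional mean zero, its conditional L¹ norm is twice
that of its positive part. In weak duality g is only in L¹(μ), and only an upper bound on ⟨g(u), x⟩
is at hand. -/
theorem Feasible.integrable_inner_of_posPart [IsFiniteMeasure ν] (hπ : Feasible μ ν π)
    (hν : Integrable (fun w => ‖w.1‖ ^ 2 + ‖w.2‖ ^ 2) ν) {g : E dy → E dx} (hg : Measurable g)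
    (hpos : Integrable (fun z : Z dx dy => max (inner ℝ (g z.1) z.2.1) 0)
      (π : Measure (Z dx dy))) :
    Integrable (fun z : Z dx dy => inner ℝ (g z.1) z.2.1) (π : Measure (Z dx dy)) := by
  have hm : Measurable fun z : Z dx dy => inner ℝ (g z.1) z.2.1 := by fun_prop
  rw [← hm.aestronglyMeasurable.ae_integrable_condKernel_iff, hπ.fst_eq]
  have hae := hπ.ae_integral_inner_eq_zero hν g
  refine ⟨hae.mono fun u hu => hu.1, ?_⟩
  have h1 := hpos.integral_condKernel
  have h2 := hpos.condKernel_ae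
  rw [hπ.fst_eq] at h1 h2
  refine (h1.const_mul 2).congr ?_
  filter_upwards [hae, h2] with u hu hu2
  have habs : ∀ w : E dx × E dy, ‖inner ℝ (g u) w.1‖
      = 2 * max (inner ℝ (g u) w.1) 0 - inner ℝ (g u) w.1 := by
    intro w
    rw [norm_eq_abs]
    rcases le_total 0 (inner ℝ (g u) w.1) with h | h
    · rw [abs_of_nonneg h, max_eq_left h]; ring
    · rw [abs_of_nonpos h, max_eq_right h]; ring
  simp only [habs]
  rw [integral_sub (hu2.const_mul 2) hu.1, hu.2, integral_const_mul, sub_zero]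

theorem integral_prod_constraintSpace [IsProbabilityMeasure μ] [IsProbabilityMeasure ν]
    (hν : Integrable (fun w => ‖w.1‖ ^ 2 + ‖w.2‖ ^ 2) ν) (hmean : ∫ w, w.1 ∂ν = 0)
    {g : E dy → E dx} (hg : Integrable (fun z : Z dx dy => inner ℝ (g z.1) z.2.1) (μ.prod ν)) :
    ∫ z : Z dx dy, inner ℝ (g z.1) z.2.1 ∂(μ.prod ν) = 0 := by
  rw [integral_prod _ hg]
  simp only [integral_inner (EntropicVQR.integrable_fst hν), hmean, inner_zero_right,
    integral_zero]

theorem integrable_weight_sq [IsFiniteMeasure ν]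
    (hν : Integrable (fun w => ‖w.1‖ ^ 2 + ‖w.2‖ ^ 2) ν) {γ : Measure (Z dx dy)}
    (hγ : IsCoupling γ μ ν) :
    Integrable (fun z => weight z ^ 2) γ ∧
      ∫ z, weight z ^ 2 ∂γ = ∫ w, (1 + ‖w.1‖) ^ 2 ∂ν := by
  have h : Integrable (fun w : E dx × E dy => (1 + ‖w.1‖) ^ 2) ν := by
    refine (((integrable_norm_fst_sq hν).const_mul 2).add (integrable_const 2)).mono'
      (by fun_prop) (ae_of_all _ fun w => ?_)
    rw [norm_of_nonneg (sq_nonneg _)]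
    simp only [Pi.add_apply]
    nlinarith [sq_nonneg (1 - ‖w.1‖)]
  exact ⟨hγ.integrable_snd h, hγ.integral_snd h⟩

theorem Feasible.integral_eq [IsProbabilityMeasure μ] [IsProbabilityMeasure ν]
    (hπ : Feasible μ ν π) (hν : Integrable (fun w => ‖w.1‖ ^ 2 + ‖w.2‖ ^ 2) ν)
    (hmean : ∫ w, w.1 ∂ν = 0) {v : Z dx dy → ℝ} (hv : v ∈ constraintSpace dx dy) :
    ∫ z, v z ∂(π : Measure (Z dx dy)) = ∫ z, v z ∂(μ.prod ν) := by
  obtain ⟨f, g, h, ⟨hf, hg, hh⟩, ⟨M, hM1, hM2, hM3⟩, rfl⟩ := hv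
  have hfi : Integrable f μ := (integrable_const M).mono' hf.aestronglyMeasurable (ae_of_all _ hM1)
  have hhi : Integrable h ν := (integrable_const M).mono' hh.aestronglyMeasurable (ae_of_all _ hM3)
  have hgi : ∀ γ : Measure (Z dx dy), IsCoupling γ μ ν →
      Integrable (fun z : Z dx dy => inner ℝ (g z.1) z.2.1) γ := by
    intro γ hγ
    refine ((hγ.integrable_snd (integrable_fst hν)).norm.const_mul M).mono' (by fun_prop)
      (ae_of_all _ fun z => ?_)
    exact (abs_real_inner_le_norm _ _).trans (mul_le_mul_of_nonneg_right (hM2 _) (norm_nonneg _))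
  have key : ∀ γ : Measure (Z dx dy), IsCoupling γ μ ν →
      ∫ z : Z dx dy, inner ℝ (g z.1) z.2.1 ∂γ = 0 →
      ∫ z, (f z.1 + inner ℝ (g z.1) z.2.1 + h z.2) ∂γ = ∫ u, f u ∂μ + ∫ w, h w ∂ν := by
    intro γ hγ h0
    have hfg : Integrable (fun z : Z dx dy => f z.1 + inner ℝ (g z.1) z.2.1) γ :=
      (hγ.integrable_fst hfi).add (hgi γ hγ)
    rw [integral_add hfg (hγ.integrable_snd hhi),
      integral_add (hγ.integrable_fst hfi) (hgi γ hγ), h0, hγ.integral_fst hfi,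
      hγ.integral_snd hhi, add_zero]
  rw [key _ hπ.1 (hπ.integral_inner_eq_zero hν (hgi _ hπ.1)),
    key _ isCoupling_prod (integral_prod_constraintSpace hν hmean (hgi _ isCoupling_prod))]

/-- f and h test the two marginals, and g tests the conditional mean of x. -/
theorem feasible_of_integral_eq [IsProbabilityMeasure μ] [IsProbabilityMeasure ν]
    (hν : Integrable (fun w => ‖w.1‖ ^ 2 + ‖w.2‖ ^ 2) ν)
    (hmean : ∫ w, w.1 ∂ν = 0) (h : ∀ v ∈ constraintSpace dx dy,
      ∫ z, v z ∂(π : Measure (Z dx dy)) = ∫ z, v z ∂(μ.prod ν)) : Feasible μ ν π := by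
  have hset : ∀ s : Set (Z dx dy), MeasurableSet s →
      (s.indicator fun _ => (1 : ℝ)) ∈ constraintSpace dx dy →
      (π : Measure (Z dx dy)) s = (μ.prod ν) s := by
    intro s hs hmem
    have := h _ hmem
    rw [integral_indicator_const _ hs, integral_indicator_const _ hs, smul_eq_mul, smul_eq_mul,
      mul_one, mul_one, measureReal_eq_measureReal_iff] at this
    exact this
  have hind : ∀ {α : Type} [MeasurableSpace α] (s : Set α) (a : α),
      |s.indicator (fun _ => (1 : ℝ)) a| ≤ 1 := by
    intro α _ s a
    by_cases ha : a ∈ s <;> simp [ha]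
  have hc : IsCoupling (π : Measure (Z dx dy)) μ ν := by
    have hR : IsCoupling (μ.prod ν) μ ν := isCoupling_prod
    constructor
    · rw [← hR.1]
      ext s hs
      rw [Measure.map_apply measurable_fst hs, Measure.map_apply measurable_fst hs]
      exact hset _ (measurable_fst hs) (comp_fst_mem_constraintSpace
        (measurable_const.indicator hs) (hind s))
    · rw [← hR.2]
      ext s hs
      rw [Measure.map_apply measurable_snd hs, Measure.map_apply measurable_snd hs]
      exact hset _ (measurable_snd hs) (comp_snd_mem_constraintSpace
        (measurable_const.indicator hs) (hind s))
  refine ⟨hc, ?_⟩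
  have hfst : (π : Measure (Z dx dy)).fst = μ := hc.1
  have hx := hc.integrable_snd (integrable_fst hν)
  have hm := hx.integral_condKernel
  have hxk := hx.condKernel_ae
  rw [hfst] at hm hxk
  refine hm.ae_eq_zero_of_forall_setIntegral_eq_zero fun s hs _ => ?_
  -- Testing with g = 1_s a, where a is the integral to be shown zero, gives ‖a‖² = 0.
  set a : E dx := ∫ u in s, ∫ w, w.1 ∂((π : Measure (Z dx dy)).condKernel u) ∂μ with ha
  have hgm : Measurable (s.indicator fun _ => a) := measurable_const.indicator hs
  have hgb : ∀ u, ‖s.indicator (fun _ => a) u‖ ≤ ‖a‖ := fun u => norm_indicator_le_norm_self _ u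
  have hgi : ∀ γ : Measure (Z dx dy), IsCoupling γ μ ν →
      Integrable (fun z : Z dx dy => inner ℝ (s.indicator (fun _ => a) z.1) z.2.1) γ := by
    intro γ hγ
    refine ((hγ.integrable_snd (integrable_fst hν)).norm.const_mul ‖a‖).mono' (by fun_prop)
      (ae_of_all _ fun z => ?_)
    exact (abs_real_inner_le_norm _ _).trans (mul_le_mul_of_nonneg_right (hgb _) (norm_nonneg _))
  have h0 := h _ (inner_mem_constraintSpace hgm hgb)
  rw [integral_prod_constraintSpace hν hmean (hgi _ isCoupling_prod),
    ← Measure.integral_condKernel (hgi _ hc), hfst] at h0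
  rw [← inner_self_eq_zero (𝕜 := ℝ)]
  nth_rewrite 2 [ha]
  rw [← integral_inner hm.integrableOn, ← h0, ← integral_indicator hs]
  refine integral_congr_ae ?_
  filter_upwards [hxk] with u hu
  by_cases hus : u ∈ s
  · simp only [hus, indicator_of_mem]
    exact (integral_inner hu a).symm
  · simp [hus]

end Feasibility
end EntropicVQR

namespace EntropicVQR
open Filter Topology
open InformationTheory
open Real (norm_eq_abs norm_of_nonneg log exp)

/-! ### Primal objective, densities and weak duality. -/

section Duality

variable {dx dy : ℕ} {ε : ℝ} {μ : Measure (E dy)} {ν : Measure (E dx × E dy)}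

theorem integrable_cost [IsProbabilityMeasure μ] [IsProbabilityMeasure ν]
    (hμ : Integrable (fun u => ‖u‖ ^ 2) μ) (hν : Integrable (fun w => ‖w.1‖ ^ 2 + ‖w.2‖ ^ 2) ν) :
    Integrable (cost : Z dx dy → ℝ) (μ.prod ν) := by
  refine ((isCoupling_prod.integrable_fst hμ).add
    (isCoupling_prod.integrable_snd (integrable_norm_snd_sq hν))).mono'
    measurable_cost.aestronglyMeasurable (ae_of_all _ fun z => ?_)
  rw [norm_of_nonneg (cost_nonneg z)]
  simp only [cost, Pi.add_apply]
  have h := norm_sub_le z.1 z.2.2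
  nlinarith [sq_nonneg (‖z.1‖ - ‖z.2.2‖), norm_nonneg (z.1 - z.2.2), norm_nonneg z.1,
    norm_nonneg z.2.2]

/-- The densities of feasible couplings with finite objective. -/
abbrev IsVQRDensity (ε : ℝ) (μ : Measure (E dy)) (ν : Measure (E dx × E dy))
    (p : Z dx dy → ℝ) : Prop :=
  IsAdmissibleDensity (μ.prod ν) (fun z => cost z / ε) weight (constraintSpace dx dy) p

section WithDensity

variable {p : Z dx dy → ℝ} {π : ProbabilityMeasure (Z dx dy)}

theorem feasible_of_isVQRDensity [IsProbabilityMeasure μ] [IsProbabilityMeasure ν]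
    (hν : Integrable (fun w => ‖w.1‖ ^ 2 + ‖w.2‖ ^ 2) ν) (hmean : ∫ w, w.1 ∂ν = 0)
    (hp : IsVQRDensity ε μ ν p)
    (hπ : (π : Measure (Z dx dy)) = (μ.prod ν).withDensity fun z => ENNReal.ofReal (p z)) :
    Feasible μ ν π := by
  refine feasible_of_integral_eq hν hmean fun v hv => ?_
  rw [hπ, integral_withDensity_ofReal hp.measurable hp.nonneg, hp.integral_eq v hv]

theorem isEntropyProblem [IsProbabilityMeasure μ] [IsProbabilityMeasure ν] (hε : 0 < ε)
    (hμ : Integrable (fun u => ‖u‖ ^ 2) μ) (hν : Integrable (fun w => ‖w.1‖ ^ 2 + ‖w.2‖ ^ 2) ν)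
    (hmean : ∫ w, w.1 ∂ν = 0) :
    IsEntropyProblem (μ.prod ν) (fun z : Z dx dy => cost z / ε) weight (constraintSpace dx dy) where
  measurable_cost := measurable_cost.div_const ε
  cost_nonneg z := div_nonneg (cost_nonneg z) hε.le
  integrable_cost := (integrable_cost hμ hν).div_const ε
  measurable_weight := measurable_weight
  one_le_weight z := by unfold weight; linarith [norm_nonneg z.2.1]
  integrable_weight := (integrable_weight_sq hν isCoupling_prod).1
  measurable_constraint v hv := measurable_of_mem_constraintSpace hv
  bound_constraint v hv := exists_abs_le_mul_weight hv
  one_mem := comp_fst_mem_constraintSpace (f := fun _ => 1) measurable_const (M := 1) (by simp)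
  -- Equality holds: the weight depends on x alone, whose law is fixed by the marginal ν.
  integral_weight_le p hp := by
    have hone : (fun _ => (1 : ℝ)) ∈ constraintSpace dx dy :=
      comp_fst_mem_constraintSpace (f := fun _ => 1) measurable_const (M := 1) (by simp)
    have hp1 : ∫ z, p z ∂(μ.prod ν) = 1 := by simpa using hp.integral_eq _ hone
    have hpi : Integrable p (μ.prod ν) := by
      by_contra h
      rw [integral_undef h] at hp1
      exact zero_ne_one hp1
    let π : ProbabilityMeasure (Z dx dy) :=
      ⟨_, isProbabilityMeasure_withDensity_ofReal hp.nonneg hpi hp1⟩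
    have hπ : Feasible μ ν π := feasible_of_isVQRDensity hν hmean hp rfl
    rw [← integral_withDensity_ofReal hp.measurable hp.nonneg,
      (integrable_weight_sq hν (isCoupling_prod (μ := μ))).2]
    exact (integrable_weight_sq hν hπ.1).2.le

/-- Writing the divergence with `klFun` makes both terms nonnegative, so they merge in [0, ∞] and
finiteness of the objective is integrability of one function. -/
theorem primalObj_eq_lintegral [IsProbabilityMeasure μ] [IsProbabilityMeasure ν] (hε : 0 < ε)
    (hac : (π : Measure (Z dx dy)) ≪ μ.prod ν) :
    primalObj ε μ ν π = ENNReal.ofReal ε * ∫⁻ z, ENNReal.ofReal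
      (cost z / ε * ((π : Measure (Z dx dy)).rnDeriv (μ.prod ν) z).toReal +
        klFun ((π : Measure (Z dx dy)).rnDeriv (μ.prod ν) z).toReal) ∂(μ.prod ν) := by
  have hm : Measurable fun z => ((π : Measure (Z dx dy)).rnDeriv (μ.prod ν) z).toReal :=
    (Measure.measurable_rnDeriv _ _).ennreal_toReal
  have hsum : ∀ z, ENNReal.ofReal
      (cost z / ε * ((π : Measure (Z dx dy)).rnDeriv (μ.prod ν) z).toReal +
        klFun ((π : Measure (Z dx dy)).rnDeriv (μ.prod ν) z).toReal) =
      ENNReal.ofReal (cost z / ε * ((π : Measure (Z dx dy)).rnDeriv (μ.prod ν) z).toReal) +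
      ENNReal.ofReal (klFun ((π : Measure (Z dx dy)).rnDeriv (μ.prod ν) z).toReal) := fun z =>
    ENNReal.ofReal_add (mul_nonneg (div_nonneg (cost_nonneg z) hε.le) ENNReal.toReal_nonneg)
      (klFun_nonneg ENNReal.toReal_nonneg)
  have hcm : Measurable fun z => ENNReal.ofReal
      (cost z / ε * ((π : Measure (Z dx dy)).rnDeriv (μ.prod ν) z).toReal) :=
    ((measurable_cost.div_const ε).mul hm).ennreal_ofReal
  simp only [hsum]
  rw [lintegral_add_left hcm, mul_add, primalObj, klDiv_eq_lintegral_klFun_of_ac hac,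
    ← lintegral_rnDeriv_mul hac measurable_cost.ennreal_ofReal.aemeasurable,
    ← lintegral_const_mul _ hcm]
  congr 1
  refine lintegral_congr_ae ?_
  filter_upwards [Measure.rnDeriv_lt_top (π : Measure (Z dx dy)) (μ.prod ν)] with z hz
  rw [← ENNReal.ofReal_mul hε.le, ← mul_assoc, mul_div_cancel₀ _ hε.ne',
    ENNReal.ofReal_mul (cost_nonneg z), ENNReal.ofReal_toReal hz.ne, mul_comm]

theorem primalObj_eq_energy [IsProbabilityMeasure μ] [IsProbabilityMeasure ν] (hε : 0 < ε)
    (hp : IsVQRDensity ε μ ν p)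
    (hπ : (π : Measure (Z dx dy)) = (μ.prod ν).withDensity fun z => ENNReal.ofReal (p z)) :
    primalObj ε μ ν π = ENNReal.ofReal (ε * energy (μ.prod ν) (fun z => cost z / ε) p) := by
  have hac : (π : Measure (Z dx dy)) ≪ μ.prod ν := hπ ▸ withDensity_absolutelyContinuous _ _
  have hrn : (π : Measure (Z dx dy)).rnDeriv (μ.prod ν) =ᵐ[μ.prod ν]
      fun z => ENNReal.ofReal (p z) := by
    rw [hπ]
    exact Measure.rnDeriv_withDensity _ hp.measurable.ennreal_ofReal
  rw [primalObj_eq_lintegral hε hac, ENNReal.ofReal_mul hε.le, energy,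
    ofReal_integral_eq_lintegral_ofReal hp.integrable_energy (ae_of_all _ fun z =>
      add_nonneg (mul_nonneg (div_nonneg (cost_nonneg z) hε.le) (hp.nonneg z))
        (klFun_nonneg (hp.nonneg z)))]
  congr 1
  refine lintegral_congr_ae ?_
  filter_upwards [hrn] with z hz
  rw [hz, ENNReal.toReal_ofReal (hp.nonneg z)]

/-- A feasible coupling with finite objective has an admissible density. -/
theorem Feasible.exists_isVQRDensity [IsProbabilityMeasure μ] [IsProbabilityMeasure ν]
    (hε : 0 < ε) (hν : Integrable (fun w => ‖w.1‖ ^ 2 + ‖w.2‖ ^ 2) ν) (hmean : ∫ w, w.1 ∂ν = 0)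
    (hπ : Feasible μ ν π) (hfin : primalObj ε μ ν π ≠ ∞) :
    ∃ p, IsVQRDensity ε μ ν p ∧
      (π : Measure (Z dx dy)) = (μ.prod ν).withDensity fun z => ENNReal.ofReal (p z) := by
  have hac : (π : Measure (Z dx dy)) ≪ μ.prod ν := by
    by_contra h
    refine hfin ?_
    rw [primalObj, klDiv_of_not_ac h, ENNReal.mul_top (ENNReal.ofReal_pos.2 hε).ne', add_top]
  rw [primalObj_eq_lintegral hε hac] at hfin
  set p : Z dx dy → ℝ := fun z => ((π : Measure (Z dx dy)).rnDeriv (μ.prod ν) z).toReal with hpdef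
  have hm : Measurable p := (Measure.measurable_rnDeriv _ _).ennreal_toReal
  have hp0 : ∀ z, 0 ≤ p z := fun z => ENNReal.toReal_nonneg
  have hπp : (π : Measure (Z dx dy)) = (μ.prod ν).withDensity fun z => ENNReal.ofReal (p z) := by
    rw [← Measure.withDensity_rnDeriv_eq _ _ hac]
    refine withDensity_congr_ae ?_
    filter_upwards [Measure.rnDeriv_lt_top (π : Measure (Z dx dy)) (μ.prod ν)] with z hz
    exact (ENNReal.ofReal_toReal hz.ne).symm
  have hc0 : ∀ z, 0 ≤ cost z / ε * p z := fun z =>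
    mul_nonneg (div_nonneg (cost_nonneg z) hε.le) (hp0 z)
  have hk0 : ∀ z, 0 ≤ klFun (p z) := fun z => klFun_nonneg (hp0 z)
  have hcm : Measurable fun z => cost z / ε * p z := (measurable_cost.div_const ε).mul hm
  have hkm : Measurable fun z => klFun (p z) := measurable_klFun.comp hm
  have hint : Integrable (fun z => cost z / ε * p z + klFun (p z)) (μ.prod ν) := by
    refine (lintegral_ofReal_ne_top_iff_integrable (hcm.add hkm).aestronglyMeasurable
      (ae_of_all _ fun z => add_nonneg (hc0 z) (hk0 z))).1 fun h => hfin ?_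
    erw [h, ENNReal.mul_top (ENNReal.ofReal_pos.2 hε).ne']
  refine ⟨p, ⟨hm, hp0, ?_, ?_, ?_, fun v hv => ?_⟩, hπp⟩
  · rw [← integrable_withDensity_ofReal_iff hm hp0, ← hπp]
    exact (integrable_weight_sq hν hπ.1).1
  · refine hint.mono' hcm.aestronglyMeasurable (ae_of_all _ fun z => ?_)
    rw [norm_of_nonneg (hc0 z)]
    linarith [hk0 z]
  · refine hint.mono' hkm.aestronglyMeasurable (ae_of_all _ fun z => ?_)
    rw [norm_of_nonneg (hk0 z)]
    linarith [hc0 z]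
  · rw [← integral_withDensity_ofReal hm hp0, ← hπp, hπ.integral_eq hν hmean hv]

theorem integral_add_mul_log_eq_energy [IsProbabilityMeasure μ] [IsProbabilityMeasure ν]
    (hP : IsEntropyProblem (μ.prod ν) (fun z : Z dx dy => cost z / ε) weight
      (constraintSpace dx dy))
    (hp : IsVQRDensity ε μ ν p) :
    ∫ z, (log (p z) + cost z / ε) * p z ∂(μ.prod ν)
      = energy (μ.prod ν) (fun z => cost z / ε) p := by
  have hpi := hP.integrable_density hp
  have hpi1 : Integrable (fun z => p z - 1) (μ.prod ν) := hpi.sub (integrable_const 1)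
  have h : ∀ z, (log (p z) + cost z / ε) * p z
      = (cost z / ε * p z + klFun (p z)) + (p z - 1) := fun z => by
    rw [klFun_apply]; ring
  simp only [h]
  rw [integral_add hp.integrable_energy hpi1,
    integral_sub hpi (integrable_const 1), hP.integral_density hp]
  simp [energy]

/-- Fenchel–Young for the exponential: its graph lies above the tangent at log p. -/
theorem mul_sub_log_le {p s : ℝ} (hp : 0 ≤ p) : p * (s - log p) ≤ exp s - p := by
  rcases hp.eq_or_lt with rfl | hp
  · simpa using (Real.exp_pos s).le
  have h := Real.add_one_le_exp (s - log p)
  rw [Real.exp_sub, Real.exp_log hp, le_div_iff₀ hp] at h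
  linarith

/-- Weak duality. -/
theorem dualObj_le_energy [IsProbabilityMeasure μ] [IsProbabilityMeasure ν]
    (hε : 0 < ε) (hν : Integrable (fun w => ‖w.1‖ ^ 2 + ‖w.2‖ ^ 2) ν)
    (hP : IsEntropyProblem (μ.prod ν) (fun z : Z dx dy => cost z / ε) weight
      (constraintSpace dx dy))
    (hp : IsVQRDensity ε μ ν p) (hπ : Feasible μ ν π)
    (hπp : (π : Measure (Z dx dy)) = (μ.prod ν).withDensity fun z => ENNReal.ofReal (p z))
    {f : E dy → ℝ} {g : E dy → E dx} {h : E dx × E dy → ℝ} (hadm : DualAdmissible μ ν f g h) :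
    dualObj ε μ ν f g h ≤ ((ε * energy (μ.prod ν) (fun z => cost z / ε) p : ℝ) : EReal) := by
  have hqm : Measurable (gibbsDensity ε f g h : Z dx dy → ℝ) := by
    have := hadm.measurable_f
    have := hadm.measurable_g
    have := hadm.measurable_h
    have := measurable_cost (dx := dx) (dy := dy)
    unfold gibbsDensity
    fun_prop
  have hq0 : ∀ z : Z dx dy, 0 ≤ gibbsDensity ε f g h z := fun z => (Real.exp_pos _).le
  by_cases htop : ∫⁻ z : Z dx dy, ENNReal.ofReal (gibbsDensity ε f g h z) ∂(μ.prod ν) = ∞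
  · rw [dualObj, iota, htop, ENNReal.mul_top (ENNReal.ofReal_pos.2 hε).ne', EReal.coe_ennreal_top,
      EReal.top_sub_coe, EReal.sub_top]
    exact bot_le
  have hqi : Integrable (gibbsDensity ε f g h : Z dx dy → ℝ) (μ.prod ν) :=
    (lintegral_ofReal_ne_top_iff_integrable hqm.aestronglyMeasurable (ae_of_all _ hq0)).1 htop
  have hfp : Integrable (fun z => f z.1 * p z) (μ.prod ν) := by
    rw [← integrable_withDensity_ofReal_iff hp.measurable hp.nonneg, ← hπp]
    exact hπ.1.integrable_fst hadm.integrable_f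
  have hhp : Integrable (fun z => h z.2 * p z) (μ.prod ν) := by
    rw [← integrable_withDensity_ofReal_iff hp.measurable hp.nonneg, ← hπp]
    exact hπ.1.integrable_snd hadm.integrable_h
  have hpi := hP.integrable_density hp
  have hlp : Integrable (fun z => (log (p z) + cost z / ε) * p z) (μ.prod ν) :=
    ((hP.integrable_mul_log hp).add hp.integrable_cost).congr
      (ae_of_all _ fun z => by simp only [Pi.add_apply]; ring)
  have hKi : Integrable (fun z => ε * (gibbsDensity ε f g h z - p z +
      (log (p z) + cost z / ε) * p z) - f z.1 * p z - h z.2 * p z) (μ.prod ν) :=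
    ((((hqi.sub hpi).add hlp).const_mul ε).sub hfp).sub hhp
  -- Fenchel–Young solved for the term in g, the only one not yet known to be integrable: it lies
  -- below an integrable function, so its positive part is integrable.
  have hpt : ∀ z : Z dx dy, inner ℝ (g z.1) z.2.1 * p z ≤ ε * (gibbsDensity ε f g h z - p z +
      (log (p z) + cost z / ε) * p z) - f z.1 * p z - h z.2 * p z := by
    intro z
    have h1 := mul_le_mul_of_nonneg_left (mul_sub_log_le (hp.nonneg z)
      (s := (1 / ε) * (f z.1 + inner ℝ (g z.1) z.2.1 + h z.2 - cost z))) hε.le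
    have h2 : ε * (p z * ((1 / ε) * (f z.1 + inner ℝ (g z.1) z.2.1 + h z.2 - cost z) - log (p z)))
        = p z * (f z.1 + inner ℝ (g z.1) z.2.1 + h z.2) -
          ε * ((log (p z) + cost z / ε) * p z) := by
      field_simp
      ring
    rw [h2] at h1
    unfold gibbsDensity
    linarith
  have hgm : Measurable fun z : Z dx dy => inner ℝ (g z.1) z.2.1 := by
    have := hadm.measurable_g
    fun_prop
  have hgπ : Integrable (fun z : Z dx dy => inner ℝ (g z.1) z.2.1) (π : Measure (Z dx dy)) := by
    refine hπ.integrable_inner_of_posPart hν hadm.measurable_g ?_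
    rw [hπp, integrable_withDensity_ofReal_iff hp.measurable hp.nonneg]
    refine hKi.norm.mono' ((hgm.max measurable_const).mul hp.measurable).aestronglyMeasurable
      (ae_of_all _ fun z => ?_)
    rw [norm_of_nonneg (mul_nonneg (le_max_right _ _) (hp.nonneg z)), max_mul_of_nonneg _ _
      (hp.nonneg z), zero_mul]
    exact max_le ((hpt z).trans (le_abs_self _)) (norm_nonneg _)
  have hg0 : ∫ z : Z dx dy, inner ℝ (g z.1) z.2.1 * p z ∂(μ.prod ν) = 0 := by
    rw [← integral_withDensity_ofReal hp.measurable hp.nonneg, ← hπp,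
      hπ.integral_inner_eq_zero hν hgπ]
  have hgi : Integrable (fun z : Z dx dy => inner ℝ (g z.1) z.2.1 * p z) (μ.prod ν) := by
    rwa [← integrable_withDensity_ofReal_iff hp.measurable hp.nonneg, ← hπp]
  have hf1 : ∫ z, f z.1 * p z ∂(μ.prod ν) = ∫ u, f u ∂μ := by
    rw [← integral_withDensity_ofReal hp.measurable hp.nonneg (fun z => f z.1), ← hπp,
      hπ.1.integral_fst hadm.integrable_f]
  have hh1 : ∫ z, h z.2 * p z ∂(μ.prod ν) = ∫ w, h w ∂ν := by
    rw [← integral_withDensity_ofReal hp.measurable hp.nonneg (fun z => h z.2), ← hπp,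
      hπ.1.integral_snd hadm.integrable_h]
  have hle := integral_mono hgi hKi hpt
  have hA : Integrable (fun z => gibbsDensity ε f g h z - p z) (μ.prod ν) := hqi.sub hpi
  have hB : Integrable (fun z => ε * (gibbsDensity ε f g h z - p z +
      (log (p z) + cost z / ε) * p z)) (μ.prod ν) := (hA.add hlp).const_mul ε
  have hC : Integrable (fun z => ε * (gibbsDensity ε f g h z - p z +
      (log (p z) + cost z / ε) * p z) - f z.1 * p z) (μ.prod ν) := hB.sub hfp
  rw [hg0, integral_sub hC hhp, integral_sub hB hfp, integral_const_mul, integral_add hA hlp,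
    integral_sub hqi hpi, hP.integral_density hp, integral_add_mul_log_eq_energy hP hp, hf1,
    hh1] at hle
  rw [dualObj, iota, ← ofReal_integral_eq_lintegral_ofReal hqi (ae_of_all _ hq0),
    ← ENNReal.ofReal_mul hε.le, EReal.coe_ennreal_ofReal,
    max_eq_left (mul_nonneg hε.le (integral_nonneg hq0)), ← EReal.coe_sub, ← EReal.coe_sub,
    EReal.coe_le_coe_iff]
  linarith

end WithDensity

end Duality
end EntropicVQR

/-! ### Strong duality and attainment. -/

open EntropicVQR in
theorem mainTheorem1 (dx dy : ℕ) (ε : ℝ) (hε : 0 < ε)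
    (μ : Measure (E dy)) [IsProbabilityMeasure μ]
    (ν : Measure (E dx × E dy)) [IsProbabilityMeasure ν]
    (hμ : Integrable (fun u => ‖u‖ ^ 2) μ)
    (hν : Integrable (fun w => ‖w.1‖ ^ 2 + ‖w.2‖ ^ 2) ν)
    (hmean : ∫ w, w.1 ∂ν = 0)
    (hinv : IsUnit (secondMoment ν))
    (hcoer : KLCoercive (refMeasure ε μ ν)) :
    (primalValue ε μ ν : EReal) = dualValue ε μ ν ∧
    ∃ π : ProbabilityMeasure (Z dx dy),
      IsPrimalOptimal ε μ ν π ∧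
      (∀ π' : ProbabilityMeasure (Z dx dy), IsPrimalOptimal ε μ ν π' → π' = π) ∧
      ∃ (f : E dy → ℝ) (g : E dy → E dx) (h : E dx × E dy → ℝ),
        DualAdmissible μ ν f g h ∧
        (π : Measure (Z dx dy)) ≪ μ.prod ν ∧
        (π : Measure (Z dx dy)).rnDeriv (μ.prod ν) =ᵐ[μ.prod ν]
          (fun z => ENNReal.ofReal (gibbsDensity ε f g h z)) ∧
        dualObj ε μ ν f g h = dualValue ε μ ν ∧
        (primalValue ε μ ν : EReal) = ((∫ u, f u ∂μ + ∫ w, h w ∂ν : ℝ) : EReal) := by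
  have hP := isEntropyProblem hε hμ hν hmean
  obtain ⟨p, hp, hmin⟩ := hP.exists_minimizer
  let π : ProbabilityMeasure (Z dx dy) := ⟨_, isProbabilityMeasure_withDensity_ofReal hp.nonneg
    (hP.integrable_density hp) (hP.integral_density hp)⟩
  have hπp : (π : Measure (Z dx dy)) = (μ.prod ν).withDensity fun z => ENNReal.ofReal (p z) := rfl
  have hπ : Feasible μ ν π := feasible_of_isVQRDensity hν hmean hp hπp
  have hobj := primalObj_eq_energy hε hp hπp
  set J := energy (μ.prod ν) (fun z : Z dx dy => cost z / ε) with hJ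
  have hJ0 : 0 ≤ J p := integral_nonneg fun z => add_nonneg
    (mul_nonneg (div_nonneg (cost_nonneg z) hε.le) (hp.nonneg z))
    (InformationTheory.klFun_nonneg (hp.nonneg z))
  have hval : primalValue ε μ ν = ENNReal.ofReal (ε * J p) := by
    refine le_antisymm ((iInf₂_le π hπ).trans_eq hobj) (le_iInf₂ fun π' hπ' => ?_)
    by_cases htop : primalObj ε μ ν π' = ∞
    · exact htop ▸ le_top
    obtain ⟨p', hp', hπp'⟩ := hπ'.exists_isVQRDensity hε hν hmean htop
    rw [primalObj_eq_energy hε hp' hπp']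
    exact ENNReal.ofReal_le_ofReal (mul_le_mul_of_nonneg_left (hmin p' hp') hε.le)
  have hvalE : (primalValue ε μ ν : EReal) = ((ε * J p : ℝ) : EReal) := by
    rw [hval, EReal.coe_ennreal_ofReal, max_eq_left (mul_nonneg hε.le hJ0)]
  obtain ⟨v, hv, hlim⟩ := hP.exists_seq_tendsto_log_add_cost hp hmin
  choose f₀ g₀ h₀ hmeas _ hveq using hv
  obtain ⟨f, g, h, hf, hg, hh, hF⟩ := exists_eq_add_inner_add_of_tendsto (μ := μ) hν hmean hinv
    (fun n => (hmeas n).1) (fun n => (hmeas n).2.1) (fun n => (hmeas n).2.2)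
    (F := fun z => Real.log (p z) + cost z / ε) (by simpa only [hveq] using hlim)
  obtain ⟨hfi, hgi, hhi⟩ := integrable_of_integrable_add_inner_add (μ := μ) hν hmean hinv
    (((hP.integrable_log_of_minimizer hp hmin).add hP.integrable_cost).congr hF)
  -- f, g, h split log p + c / ε, so the dual potentials carry a factor ε to offset the 1/ε in the
  -- exponent.
  have hadm : DualAdmissible μ ν (fun u => ε * f u) (fun u => ε • g u) (fun w => ε * h w) :=
    ⟨hf.const_mul ε, hg.const_smul ε, hh.const_mul ε, hfi.const_mul ε, hgi.smul ε,
      hhi.const_mul ε⟩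
  have hgibbs : ∀ᵐ z ∂(μ.prod ν),
      gibbsDensity ε (fun u => ε * f u) (fun u => ε • g u) (fun w => ε * h w) z = p z := by
    filter_upwards [hF, hP.ae_pos_of_minimizer hp hmin] with z hz hpos
    rw [gibbsDensity, ← Real.exp_log hpos, eq_sub_of_add_eq hz, real_inner_smul_left]
    congr 1
    field_simp
  have hJval : J p = ∫ u, f u ∂μ + ∫ w, h w ∂ν := by
    have hsum : Integrable (fun z : Z dx dy => f z.1 + inner ℝ (g z.1) z.2.1 + h z.2)
        (π : Measure (Z dx dy)) := by
      rw [hπp, integrable_withDensity_ofReal_iff hp.measurable hp.nonneg]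
      refine ((hP.integrable_mul_log hp).add hp.integrable_cost).congr ?_
      filter_upwards [hF] with z hz
      rw [← hz, Pi.add_apply]
      ring
    have hfπ := hπ.1.integrable_fst hfi
    have hhπ := hπ.1.integrable_snd hhi
    have hgπ : Integrable (fun z : Z dx dy => inner ℝ (g z.1) z.2.1) (π : Measure (Z dx dy)) := by
      refine ((hsum.sub hfπ).sub hhπ).congr (ae_of_all _ fun z => ?_)
      simp only [Pi.sub_apply]
      ring
    have hfg : Integrable (fun z : Z dx dy => f z.1 + inner ℝ (g z.1) z.2.1)
        (π : Measure (Z dx dy)) := hfπ.add hgπ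
    -- The energy is the π-integral of log p + c / ε, in which the ⟨g, x⟩ term integrates to zero by
    -- feasibility.
    rw [hJ, ← integral_add_mul_log_eq_energy hP hp, ← hπ.1.integral_fst hfi,
      ← hπ.1.integral_snd hhi, ← add_zero (∫ z, f z.1 ∂(π : Measure (Z dx dy))),
      ← hπ.integral_inner_eq_zero hν hgπ, ← integral_add hfπ hgπ, ← integral_add hfg hhπ, hπp,
      integral_withDensity_ofReal hp.measurable hp.nonneg]
    refine integral_congr_ae ?_
    filter_upwards [hF] with z hz
    rw [hz]
  have hdual : dualObj ε μ ν (fun u => ε * f u) (fun u => ε • g u) (fun w => ε * h w)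
      = ((ε * J p : ℝ) : EReal) := by
    -- The exponential integral is the total mass of π, so the two ε terms of the dual objective
    -- cancel.
    have h1 : ∫⁻ z, ENNReal.ofReal
        (gibbsDensity ε (fun u => ε * f u) (fun u => ε • g u) (fun w => ε * h w) z) ∂(μ.prod ν)
        = 1 := by
      rw [← (measure_univ : (π : Measure (Z dx dy)) univ = 1), hπp,
        withDensity_apply _ MeasurableSet.univ, Measure.restrict_univ]
      refine lintegral_congr_ae ?_
      filter_upwards [hgibbs] with z hz
      rw [hz]
    rw [dualObj, iota, h1, mul_one, EReal.coe_ennreal_ofReal, max_eq_left hε.le, ← EReal.coe_sub,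
      ← EReal.coe_sub, integral_const_mul, integral_const_mul, hJval]
    congr 1
    ring
  have hDual : dualValue ε μ ν = ((ε * J p : ℝ) : EReal) := by
    refine le_antisymm ?_ ?_
    · exact iSup_le fun f' => iSup_le fun g' => iSup_le fun h' => iSup_le fun hadm' =>
        dualObj_le_energy hε hν hP hp hπ hπp hadm'
    · rw [← hdual]
      exact le_iSup_of_le _ (le_iSup_of_le _ (le_iSup_of_le _ (le_iSup_of_le hadm le_rfl)))
  refine ⟨hvalE.trans hDual.symm, π, ⟨hπ, hobj.trans hval.symm⟩, fun π' hπ' => ?_, _, _, _, hadm,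
    withDensity_absolutelyContinuous _ _, ?_, hdual.trans hDual.symm, ?_⟩
  · have heq : primalObj ε μ ν π' = ENNReal.ofReal (ε * J p) := hπ'.2.trans hval
    obtain ⟨p', hp', hπp'⟩ := hπ'.1.exists_isVQRDensity hε hν hmean
      (heq ▸ ENNReal.ofReal_ne_top)
    rw [primalObj_eq_energy hε hp' hπp'] at heq
    have hle : J p' ≤ J p := le_of_mul_le_mul_left
      ((ENNReal.ofReal_le_ofReal_iff (mul_nonneg hε.le hJ0)).1 heq.le) hε
    refine Subtype.ext ?_
    change (π' : Measure (Z dx dy)) = (π : Measure (Z dx dy))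
    rw [hπp', hπp]
    refine withDensity_congr_ae ?_
    filter_upwards [hP.ae_eq_of_minimizer hp hp' hmin hle] with z hz
    rw [hz]
  · refine (Measure.rnDeriv_withDensity _ hp.measurable.ennreal_ofReal).trans ?_
    filter_upwards [hgibbs] with z hz
    rw [hz]
  · rw [hvalE, integral_const_mul, integral_const_mul, ← mul_add, hJval]
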